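/- Let $\mathbb{K}$ be an algebraically closed field of characteristic $0$, and let $p\in\mathbb{K}[x,y]\setminus(\mathbb{K}[x]\cup\mathbb{K}[y])$ be irreducible. Let $\mathbb{K}[x,y]_p$ be the ring of rational functions in $\mathbb{K}(x,y)$ whose reduced denominator is not divisible by $p$, and $\langle p\rangle$ the ideal of it generated by $p$. Let $r\in\mathbb{K}[x,y]_p\setminus\langle p\rangle$, and let $f\in\mathbb{K}(x)$, $g\in\mathbb{K}(y)$ be such that $f-g\in r+\langle p\rangle$. Let $C\subseteq\mathbb{P}^1(\mathbb{K})\times\mathbb{P}^1(\mathbb{K})$, where $\mathbb{P}^1(\mathbb{K})=\mathbb{K}\cup\{\infty\}$, be the curve defined by the bi-homogenization $x_0^{\deg_x p}y_0^{\deg_y p}p(x_1/x_0,y_1/y_0)$ of $p$. If $(\infty,\infty)\in C$, it is called a pole of $r$ if there is a Puiseux series $\varphi\in\mathbb{K}\{\{x^{-1}\}\}$ (rational exponents with a common denominator) such that $p(x,\varphi)=0$, $\deg\varphi>0$ and $\deg r(x,\varphi)>0$. A point $(s_1,s_2)\in C$ is called a pole of $r$ if there is a transformation $T=(T_1,T_2)$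 of $\mathbb{P}^1(\mathbb{K})\times\mathbb{P}^1(\mathbb{K})$, with $T_1,T_2$ invertible fractional linear maps, that maps $(s_1,s_2)$ to $(\infty,\infty)$ and is such that $(\infty,\infty)$ is a pole of $r\circ T^{-1}$ on the curve associated with the numerator of $p\circ T^{-1}$. Let $\sim$ be the smallest equivalence relation on $C$ such that $(a,b)\sim(c,d)$ whenever $a=c$ or $b=d$; its equivalence classes are called orbits. The graph of an orbit $\mathcal{O}$ has the elements of $\mathcal{O}$ as its vertices, and two distinct vertices are adjacent if they have the same first or the same second coordinate. An infinite path is a sequence $v_0,v_1,v_2,\dots$ of vertices with $v_i$ adjacent to $v_{i+1}$ for all $i$; it is cycle-free if there are no $i<j$ with $v_i=v_j$. For a subset $S$ of an orbit $\mathcal{O}$, let $\mathcal{O}(S)$ be the set of all $v\in\mathcal{O}$ for which there is no infinite cycle-free path in the graph of $\mathcal{O}$ that contains $v$ but no element of $S$. The boundary of a set $A\subseteq\mathcal{O}$ is the set of those $v\in A$ that are adjacent to some element of $\mathcal{O}\setminus A$. Let $\mathcal{O}$ be an orbit, and let $S\subseteq\mathcal{O}$ be the set of those poles $v$ of $r$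 in $\mathcal{O}$ for which there is an infinite cycle-free path in the graph of $\mathcal{O}$ that starts at $v$ and contains no pole of $r$ other than $v$. Then: 1. $\mathcal{O}(S)$ is finite; 2. every $(s_1,s_2)\in\mathcal{O}$ for which $s_1$ is a pole of $f$ or $s_2$ is a pole of $g$ belongs to $\mathcal{O}(S)$; 3. the boundary of $\mathcal{O}(S)$ is $S$; in particular, $S$ is finite, $S=\{p_1,\dots,p_k\}$, and $\mathcal{O}(S)=\mathcal{O}(p_1,\dots,p_k)$. -/

import Mathlib

noncomputable section

namespace SepVar

open scoped OnePoint

/-- The polynomial ring `K[x, y]`; `x` is `X 0` and `y` is `X 1`. -/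
abbrev Poly2 (K : Type*) [Field K] := MvPolynomial (Fin 2) K

/-- The field `K(x, y)`. -/
abbrev RatFun (K : Type*) [Field K] := FractionRing (Poly2 K)

/-- `P¹(K) × P¹(K)`, where `P¹(K) = K ∪ {∞}`. -/
abbrev Pt (K : Type*) [Field K] := OnePoint K × OnePoint K

variable {K : Type*} [Field K]

/-- The value `r(u, v) = rₙ(u, v) / r_d(u, v)` of a rational function `r = rₙ / r_d` in reduced
form at elements `u, v` of an extension field. -/
def evalRat {L : Type*} [Field L] [Algebra K L] (u v : L) (r : RatFun K) : L :=
  MvPolynomial.aeval ![u, v] (IsFractionRing.num (Poly2 K) r) /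
    MvPolynomial.aeval ![u, v] (IsFractionRing.den (Poly2 K) r : Poly2 K)

/-! ### The local ring at `p` and the set `F(r, p)` -/

/-- `K[x, y]_p`: the rational functions whose denominator is not divisible by `p`. -/
def localRing (p : Poly2 K) : Set (RatFun K) :=
  {r | ¬ p ∣ (IsFractionRing.den (Poly2 K) r : Poly2 K)}

/-- The ideal `⟨p⟩` of `K[x, y]_p`. -/
def localIdeal (p : Poly2 K) : Set (RatFun K) :=
  {r | ∃ q ∈ localRing p, r = q * algebraMap (Poly2 K) (RatFun K) p}

/-- `f ∈ K(x)`, for `i = 0`, or `f ∈ K(y)`, for `i = 1`, as an element of `K(x, y)`. -/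
def embed (i : Fin 2) (f : RatFunc K) : RatFun K :=
  RatFunc.eval (algebraMap K (RatFun K)) (algebraMap (Poly2 K) (RatFun K) (MvPolynomial.X i)) f

/-- `F(r, p) = {(f, g) ∈ K(x) × K(y) : f - g ∈ r + ⟨p⟩}`. -/
def sepSet (r : RatFun K) (p : Poly2 K) : Set (RatFunc K × RatFunc K) :=
  {fg | embed 0 fg.1 - embed 1 fg.2 - r ∈ localIdeal p}

/-! ### Poles of univariate rational functions -/

/-- `m(s, f)`: the negative of the valuation of `f` at `s ∈ K ∪ {∞}` (and `0` for `f = 0`). -/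
def poleMult (s : OnePoint K) (f : RatFunc K) : ℤ :=
  match s with
  | ∞ => f.num.natDegree - f.denom.natDegree
  | (a : K) => f.denom.rootMultiplicity a - f.num.rootMultiplicity a

/-- `s` is a pole of `f`. -/
def IsUnivPole (f : RatFunc K) (s : OnePoint K) : Prop := 0 < poleMult s f

/-! ### The curve in `P¹ × P¹` -/

/-- The bi-homogenization of `p`, in the variables `x₀ = inl 0`, `x₁ = inl 1`, `y₀ = inr 0`,
`y₁ = inr 1`: the polynomial `x₀ ^ deg_x p * y₀ ^ deg_y p * p (x₁ / x₀, y₁ / y₀)`. -/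
def biHom (p : Poly2 K) : MvPolynomial (Fin 2 ⊕ Fin 2) K :=
  ∑ m ∈ p.support, MvPolynomial.C (p.coeff m) *
    (MvPolynomial.X (Sum.inl 0) ^ (p.degreeOf 0 - m 0) * MvPolynomial.X (Sum.inl 1) ^ m 0) *
    (MvPolynomial.X (Sum.inr 0) ^ (p.degreeOf 1 - m 1) * MvPolynomial.X (Sum.inr 1) ^ m 1)

/-- Homogeneous coordinates: `(1 : a)` for `a ∈ K`, and `(0 : 1)` for `∞`. -/
def coords (s : OnePoint K) : Fin 2 → K :=
  match s with
  | ∞ => ![0, 1]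
  | (a : K) => ![1, a]

/-- The curve in `P¹ × P¹` associated with the bi-homogenization of `p`. -/
def curve (p : Poly2 K) : Set (Pt K) :=
  {s | MvPolynomial.eval (Sum.elim (coords s.1) (coords s.2)) (biHom p) = 0}

/-! ### Poles of `r` on the curve -/

/-- A generalized power series with rational exponents is a Puiseux series if its exponents have a
common denominator. -/
def IsPuiseux (φ : HahnSeries ℚ K) : Prop :=
  ∃ N : ℕ, 0 < N ∧ ∀ α ∈ φ.support, ∃ m : ℤ, α * N = m

/-- The element `x` of `K{{x⁻¹}}`; the series variable is `x⁻¹`. -/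
def serX (K : Type*) [Field K] : HahnSeries ℚ K := HahnSeries.single (-1) 1

/-- The degree in `x` of an element of `K{{x⁻¹}}` (with value `0` at the zero series; only the
positivity of degrees is used). -/
def serDeg (φ : HahnSeries ℚ K) : ℚ := -φ.order

/-- `(∞, ∞)` is a pole of `r` on the curve associated with `p`. -/
def IsPoleAtInfty (r : RatFun K) (p : Poly2 K) : Prop :=
  ((∞, ∞) : Pt K) ∈ curve p ∧
    ∃ φ : HahnSeries ℚ K, IsPuiseux φ ∧ MvPolynomial.aeval ![serX K, φ] p = 0 ∧
      0 < serDeg φ ∧ 0 < serDeg (evalRat (serX K) φ r)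

/-- The fractional linear expression `(a z + b) / (c z + d)` in `K(x, y)`, where `z` is `x`, for
`i = 0`, or `y`, for `i = 1`, and `A = (a b; c d)`. -/
def moebius (A : GL (Fin 2) K) (i : Fin 2) : RatFun K :=
  let z : RatFun K := algebraMap (Poly2 K) (RatFun K) (MvPolynomial.X i)
  let k : K → RatFun K := algebraMap K (RatFun K)
  (k (A.1 0 0) * z + k (A.1 0 1)) / (k (A.1 1 0) * z + k (A.1 1 1))

/-- `r ∘ T` for the transformation `T = (A, B)` of `P¹ × P¹`. -/
def ratComp (r : RatFun K) (A B : GL (Fin 2) K) : RatFun K :=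
  evalRat (moebius A 0) (moebius B 1) r

/-- The numerator of `p ∘ T` for the transformation `T = (A, B)` of `P¹ × P¹`. -/
def polyComp (p : Poly2 K) (A B : GL (Fin 2) K) : Poly2 K :=
  IsFractionRing.num (Poly2 K)
    (MvPolynomial.aeval ![moebius A 0, moebius B 1] p : RatFun K)

open Classical in
/-- The point `s` is a pole of `r` on the curve associated with `p`: some transformation
`T = (A, B)` of `P¹ × P¹` maps `s` to `(∞, ∞)`, and the latter is a pole of `r ∘ T⁻¹` on the curve
associated with the numerator of `p ∘ T⁻¹`. -/
def IsPole (r : RatFun K) (p : Poly2 K) (s : Pt K) : Prop :=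
  s ∈ curve p ∧ ∃ A B : GL (Fin 2) K, A • s.1 = ∞ ∧ B • s.2 = ∞ ∧
    IsPoleAtInfty (ratComp r A⁻¹ B⁻¹) (polyComp p A⁻¹ B⁻¹)

/-! ### Orbits and their graphs -/

/-- The smallest equivalence relation on the curve that relates any two points with the same first
or the same second coordinate. -/
def orbitSetoid (p : Poly2 K) : Setoid (curve p) :=
  Relation.EqvGen.setoid fun v w => v.1.1 = w.1.1 ∨ v.1.2 = w.1.2

/-- `O` is an orbit, i.e. an equivalence class of `orbitSetoid p`. -/
def IsOrbit {p : Poly2 K} (O : Set (curve p)) : Prop := O ∈ (orbitSetoid p).classes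

/-- The graph of an orbit: two (distinct) elements are adjacent if they share a coordinate. -/
def orbitGraph {p : Poly2 K} (O : Set (curve p)) : SimpleGraph O where
  Adj v w := v ≠ w ∧ (v.1.1.1 = w.1.1.1 ∨ v.1.1.2 = w.1.1.2)
  symm := ⟨fun _ _ h => ⟨h.1.symm, h.2.imp Eq.symm Eq.symm⟩⟩
  loopless := ⟨fun _ h => h.1 rfl⟩

/-- `v 0, v 1, v 2, …` is an infinite path of `G` that contains no cycle, i.e. no finite subpath
`v i, …, v j` with `i < j` and `v i = v j`. -/
def IsInfCycleFreePath {V : Type*} (G : SimpleGraph V) (v : ℕ → V) : Prop :=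
  (∀ i, G.Adj (v i) (v (i + 1))) ∧ ∀ i j, i < j → v i ≠ v j

/-- The poles of `r` in `O` at which an infinite cycle-free path in the graph of `O` starts that
does not contain any other pole of `r`. -/
def specialPoles (r : RatFun K) {p : Poly2 K} (O : Set (curve p)) : Set O :=
  {s | IsPole r p s.1.1 ∧ ∃ v : ℕ → O, IsInfCycleFreePath (orbitGraph O) v ∧ v 0 = s ∧
    ∀ i, IsPole r p (v i).1.1 → v i = s}

/-- `O(S)`: the elements `v` of `O` for which there is no infinite cycle-free path that contains
`v` but no element of `S`. -/
def enclosed {p : Poly2 K} (O : Set (curve p)) (S : Set O) : Set O :=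
  {v | ¬ ∃ w : ℕ → O, IsInfCycleFreePath (orbitGraph O) w ∧ (∃ i, w i = v) ∧ ∀ i, w i ∉ S}

/-- The boundary of a set of vertices: its elements that have a neighbour outside of it. -/
def vertexBoundary {V : Type*} (G : SimpleGraph V) (A : Set V) : Set V :=
  {v | v ∈ A ∧ ∃ w, w ∉ A ∧ G.Adj v w}

end SepVar

end

/-!
Let `s` be a point of the curve. After moving `s` to `(∞, ∞)` by fractional linear maps, the
Newton–Puiseux theorem provides a branch `y = φ(x)` of the curve through `s`, along which `r` and
`f - g` coincide, because they differ by a multiple of `p`. A pole of a univariate function at a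
coordinate of `s` is visible as positive degree along any branch through `s`. Hence a pole of `r` is
a pole of `f` in the first or of `g` in the second coordinate, and a point at which exactly one of
`f` and `g` has a pole is a pole of `r`, as nothing can cancel there.

The set `B` of the points of the orbit at which `f` or `g` has a pole is finite, since the curve has
finitely many points on each horizontal and vertical line. Neighbours share a coordinate, so at a
point of `B` with a neighbour outside `B` exactly one of `f` and `g` has a pole, and this point is a
pole of `r`. An infinite path without cycles leaves the finite set `B` for good, and it does so
through a pole of `r` from which the rest of the path is free of poles, i.e. through an element of
`S`. This puts `B` into `O(S)`. The graph is connected and locally finite, so by Kőnig's lemma the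
vertices that cannot escape without meeting the finite set `S` lie in finitely many finite
components of the complement of `S`.
-/

noncomputable section

namespace SepVar

open scoped OnePoint

universe w

variable {K : Type w} [Field K]

/-! ### Newton–Puiseux -/

section NewtonPuiseux

open Polynomial

theorem exists_isDistinguishedAt_dvd {A : Type*} [CommRing A] [IsLocalRing A]
    [IsAdicComplete (IsLocalRing.maximalIdeal A) A] {Q : A[X]} {d : ℕ}
    (hlt : ∀ i < d, Q.coeff i ∈ IsLocalRing.maximalIdeal A)
    (hd : Q.coeff d ∉ IsLocalRing.maximalIdeal A) :
    ∃ f : A[X], f.IsDistinguishedAt (IsLocalRing.maximalIdeal A) ∧ f.natDegree = d ∧ f ∣ Q := by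
  have horder : ((Q : PowerSeries A).map (IsLocalRing.residue A)).order = d := by
    rw [PowerSeries.order_eq_nat]
    simpa using ⟨not_not.1 hd, hlt⟩
  have hmap : (Q : PowerSeries A).map (IsLocalRing.residue A) ≠ 0 := fun h => by
    simp [h] at horder
  obtain ⟨f, h, H⟩ := PowerSeries.exists_isWeierstrassFactorization hmap
  refine ⟨f, H.isDistinguishedAt, ?_, ?_⟩
  · rw [H.natDegree_eq_toNat_order_map, horder, ENat.toNat_natCast]
  · have hmk : H.isDistinguishedAt.algEquivQuotient (Ideal.Quotient.mk _ Q) = 0 := by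
      simp [H.eq_mul]
    rwa [map_eq_zero_iff _ (AlgEquiv.injective _), Ideal.Quotient.eq_zero_iff_dvd] at hmk

theorem exists_isRoot_rootMultiplicity_lt {k : Type*} [Field k] [IsAlgClosed k] [CharZero k]
    {q : k[X]} (hq : q.Monic) (hnext : q.nextCoeff = 0) (hpow : q ≠ X ^ q.natDegree) :
    ∃ c, q.IsRoot c ∧ q.rootMultiplicity c < q.natDegree := by
  have hdeg : q.natDegree ≠ 0 := fun h => hpow (by rw [h, pow_zero, ← hq.natDegree_eq_zero, h])
  obtain ⟨c, hc⟩ := IsAlgClosed.exists_root q (degree_ne_of_natDegree_ne hdeg)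
  refine ⟨c, hc, lt_of_not_ge fun hle => hpow ?_⟩
  have hqc : (X - C c) ^ q.natDegree = q :=
    (eq_of_monic_of_dvd_of_natDegree_le ((monic_X_sub_C c).pow _) hq
      ((le_rootMultiplicity_iff hq.ne_zero).1 hle) (by simp)).symm
  have hc0 : c = 0 := by
    rw [← hqc, (monic_X_sub_C c).nextCoeff_pow] at hnext
    simpa [hdeg] using hnext
  rw [hc0, C_0, sub_zero] at hqc
  exact hqc.symm

theorem exists_monic_scaleRoots_eq {R : Type*} [CommRing R] {Q : R[X]} (hQ : Q.Monic) {s : R}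
    (hdvd : ∀ i, s ^ (Q.natDegree - i) ∣ Q.coeff i) :
    ∃ Q' : R[X], Q'.Monic ∧ Q'.scaleRoots s = Q := by
  nontriviality R
  choose b hb using hdvd
  set n := Q.natDegree with hn
  let Q' : R[X] := ∑ i ∈ Finset.range (n + 1), monomial i (b i)
  have hcoeff (i : ℕ) : Q'.coeff i = if i ≤ n then b i else 0 := by
    simp [Q', coeff_monomial]
  have hle : Q'.natDegree ≤ n :=
    natDegree_le_iff_coeff_eq_zero.2 fun i hi => by simp [hcoeff, hi.not_ge]
  have hone : Q'.coeff n = 1 := by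
    rw [hcoeff, if_pos le_rfl, ← hQ.coeff_natDegree, ← hn, hb n, Nat.sub_self, pow_zero, one_mul]
  have hdeg : Q'.natDegree = n := natDegree_eq_of_le_of_coeff_ne_zero hle (hone ▸ one_ne_zero)
  refine ⟨Q', monic_of_natDegree_le_of_coeff_eq_one n hle hone, ext fun i => ?_⟩
  rw [coeff_scaleRoots, hdeg, hcoeff]
  split_ifs with hi
  · rw [hb i, mul_comm]
  · rw [zero_mul, coeff_eq_zero_of_natDegree_lt (not_le.1 hi)]

section HasPuiseuxRoot

variable {Q : (PowerSeries K)[X]}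

/-- The substitution `t ↦ t ^ N` on `K[[t]]`: it realizes `K[[t]]` as a subring of
`K[[t ^ (1 / N)]]`, with the latter written as power series in `t ^ (1 / N)`. -/
abbrev expandHom (K : Type*) [Field K] (N : ℕ) (hN : N ≠ 0) : PowerSeries K →+* PowerSeries K :=
  (PowerSeries.expand (R := K) N hN : PowerSeries K →ₐ[K] PowerSeries K)

/-- `Q ∈ K[[t]][X]` has a root without constant term in some `K[[t ^ (1 / N)]]`. -/
def HasPuiseuxRoot (Q : (PowerSeries K)[X]) : Prop :=
  ∃ (N : ℕ) (hN : N ≠ 0) (ψ : PowerSeries K), PowerSeries.constantCoeff ψ = 0 ∧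
    Q.eval₂ (expandHom K N hN) ψ = 0

theorem expandHom_comp_expandHom {N M : ℕ} (hN : N ≠ 0) (hM : M ≠ 0) :
    (expandHom K N hN).comp (expandHom K M hM) = expandHom K (N * M) (mul_ne_zero hN hM) :=
  RingHom.ext fun f => (PowerSeries.expand_mul N hN M hM f).symm

theorem HasPuiseuxRoot.of_dvd {f : (PowerSeries K)[X]} (hf : HasPuiseuxRoot f) (hfQ : f ∣ Q) :
    HasPuiseuxRoot Q := by
  obtain ⟨N, hN, ψ, hψ0, hψ⟩ := hf
  exact ⟨N, hN, ψ, hψ0, eval₂_eq_zero_of_dvd_of_eval₂_eq_zero _ _ hfQ hψ⟩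

theorem hasPuiseuxRoot_of_isRoot {α : PowerSeries K} (hα : Q.IsRoot α)
    (hα0 : PowerSeries.constantCoeff α = 0) : HasPuiseuxRoot Q := by
  refine ⟨1, one_ne_zero, α, hα0, ?_⟩
  have hid : expandHom K 1 one_ne_zero = RingHom.id _ := by ext1; simp
  rwa [hid]

theorem HasPuiseuxRoot.of_taylor {α : PowerSeries K} (h : HasPuiseuxRoot (taylor α Q))
    (hα : PowerSeries.constantCoeff α = 0) : HasPuiseuxRoot Q := by
  obtain ⟨N, hN, ψ, hψ0, hψ⟩ := h
  refine ⟨N, hN, ψ + expandHom K N hN α, by simp [hψ0, hα], ?_⟩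
  simpa [taylor_apply, eval₂_comp] using hψ

theorem HasPuiseuxRoot.of_scaleRoots {Q' : (PowerSeries K)[X]} {M ν : ℕ} (hM : M ≠ 0) (hν : ν ≠ 0)
    {c : K} (h : HasPuiseuxRoot (taylor (PowerSeries.C c) Q'))
    (hQ : Q'.scaleRoots (PowerSeries.X ^ ν) = Q.map (expandHom K M hM)) : HasPuiseuxRoot Q := by
  obtain ⟨N, hN, ψ, _, hψ⟩ := h
  refine ⟨N * M, mul_ne_zero hN hM,
    expandHom K N hN (PowerSeries.X ^ ν) * (ψ + PowerSeries.C c), by simp [hν, hN], ?_⟩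
  have hroot : Q'.eval₂ (expandHom K N hN) (ψ + PowerSeries.C c) = 0 := by
    simpa [taylor_apply, eval₂_comp, PowerSeries.expand_C] using hψ
  rw [← expandHom_comp_expandHom hN hM, ← eval₂_map, ← hQ]
  exact scaleRoots_eval₂_eq_zero _ hroot

end HasPuiseuxRoot

theorem mem_maximalIdeal_iff_constantCoeff_eq_zero {f : PowerSeries K} :
    f ∈ IsLocalRing.maximalIdeal (PowerSeries K) ↔ PowerSeries.constantCoeff f = 0 := by
  rw [PowerSeries.maximalIdeal_eq_span_X, Ideal.mem_span_singleton, PowerSeries.X_dvd_iff]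

instance : IsAdicComplete (IsLocalRing.maximalIdeal (PowerSeries K)) (PowerSeries K) := by
  rw [PowerSeries.maximalIdeal_eq_span_X]
  infer_instance

theorem exists_newton_slope {o : ℕ → ℕ∞} {d : ℕ} (ho : ∃ i < d, o i ≠ ⊤) :
    ∃ M ≠ 0, ∃ ν : ℕ, (∀ i < d, ((ν * (d - i) : ℕ) : ℕ∞) ≤ M • o i) ∧
      ∃ i < d, M • o i = (ν * (d - i) : ℕ) := by
  obtain ⟨j, hj, hoj⟩ := ho
  obtain ⟨i₀, hi₀, hmin⟩ := Finset.exists_min_image {i ∈ Finset.range d | o i ≠ ⊤}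
    (fun i => ((o i).toNat : ℚ) / (d - i : ℕ)) ⟨j, by simp [hj, hoj]⟩
  simp only [Finset.mem_filter, Finset.mem_range] at hi₀ hmin
  obtain ⟨hi₀d, hoi₀⟩ := hi₀
  have hM : d - i₀ ≠ 0 := Nat.sub_ne_zero_of_lt hi₀d
  refine ⟨d - i₀, hM, (o i₀).toNat, fun i hi => ?_, i₀, hi₀d, ?_⟩
  · by_cases hoi : o i = ⊤
    · rw [hoi, nsmul_eq_mul, ENat.mul_top (by exact_mod_cast hM)]
      exact le_top
    have hslope := hmin i ⟨hi, hoi⟩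
    have hpos (k : ℕ) (hk : k < d) : (0 : ℚ) < (d - k : ℕ) := by
      exact_mod_cast Nat.sub_pos_of_lt hk
    rw [div_le_div_iff₀ (hpos i₀ hi₀d) (hpos i hi), mul_comm ((o i).toNat : ℚ)] at hslope
    rw [← ENat.natCast_toNat hoi, nsmul_eq_mul]
    exact_mod_cast hslope
  · conv_lhs => rw [← ENat.natCast_toNat hoi₀, nsmul_eq_mul, mul_comm]
    rw [Nat.cast_mul]

theorem exists_scaleRoots_eq_map_expandHom {Q : (PowerSeries K)[X]}
    (hQ : Q.IsDistinguishedAt (IsLocalRing.maximalIdeal (PowerSeries K)))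
    (hpow : Q ≠ X ^ Q.natDegree) :
    ∃ (M : ℕ) (hM : M ≠ 0) (ν : ℕ) (_ : ν ≠ 0) (Q' : (PowerSeries K)[X]), Q'.Monic ∧
      Q'.scaleRoots (PowerSeries.X ^ ν) = Q.map (expandHom K M hM) ∧
      Q'.map PowerSeries.constantCoeff ≠ X ^ Q'.natDegree := by
  have hcoeff : ∃ i < Q.natDegree, (Q.coeff i).order ≠ ⊤ := by
    contrapose! hpow
    rw [hQ.monic.as_sum, Finset.sum_eq_zero, add_zero, natDegree_X_pow]
    intro i hi
    rw [PowerSeries.order_eq_top.1 (hpow i (Finset.mem_range.1 hi)), C_0, zero_mul]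
  obtain ⟨M, hM, ν, hslope, i₀, hi₀, hν⟩ := exists_newton_slope hcoeff
  have hmonic : (Q.map (expandHom K M hM)).Monic := hQ.monic.map _
  have hdeg : (Q.map (expandHom K M hM)).natDegree = Q.natDegree := hQ.monic.natDegree_map _
  obtain ⟨Q', hQ'monic, hQ'⟩ := exists_monic_scaleRoots_eq hmonic (s := PowerSeries.X ^ ν) (by
    intro i
    rw [hdeg, coeff_map, ← pow_mul, pow_dvd_iff_le_emultiplicity,
      ← PowerSeries.order_eq_emultiplicity_X]
    rcases lt_or_ge i Q.natDegree with hi | hi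
    · exact (hslope i hi).trans_eq (PowerSeries.order_expand M hM _).symm
    · simp [Nat.sub_eq_zero_of_le hi])
  have hQ'deg : Q'.natDegree = Q.natDegree := by rw [← hdeg, ← hQ', natDegree_scaleRoots]
  refine ⟨M, hM, ν, ?_, Q', hQ'monic, hQ', fun hred => ?_⟩
  · rintro rfl
    have hi₀mem := mem_maximalIdeal_iff_constantCoeff_eq_zero.1 (hQ.mem hi₀)
    rw [← PowerSeries.order_ne_zero_iff_constCoeff_eq_zero] at hi₀mem
    simp [hM, hi₀mem] at hν
  · have hi₀red := congrArg (coeff · i₀) hred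
    simp only [coeff_map, coeff_X_pow, hQ'deg, hi₀.ne, if_false] at hi₀red
    rw [← PowerSeries.order_ne_zero_iff_constCoeff_eq_zero] at hi₀red
    have hi₀coeff : Q'.coeff i₀ * PowerSeries.X ^ (ν * (Q.natDegree - i₀)) =
        expandHom K M hM (Q.coeff i₀) := by
      rw [← coeff_map, ← hQ', coeff_scaleRoots, hQ'deg, pow_mul]
    have horder := (congrArg PowerSeries.order hi₀coeff).trans
      ((PowerSeries.order_expand M hM _).trans hν)
    rw [PowerSeries.order_mul, PowerSeries.order_X_pow] at horder
    exact hi₀red (ENat.add_left_injective_of_ne_top (ENat.natCast_ne_top _)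
      (horder.trans (zero_add _).symm))

theorem nextCoeff_scaleRoots {R : Type*} [CommRing R] (Q : R[X]) (s : R) :
    (Q.scaleRoots s).nextCoeff = Q.nextCoeff * s := by
  rcases Nat.eq_zero_or_pos Q.natDegree with hd | hd
  · simp [nextCoeff, hd]
  · rw [nextCoeff_of_natDegree_pos (by rwa [natDegree_scaleRoots]), natDegree_scaleRoots,
      coeff_scaleRoots, Nat.sub_sub_self hd, pow_one, nextCoeff_of_natDegree_pos hd]

theorem nextCoeff_taylor {R : Type*} [CommRing R] {Q : R[X]} (hQ : Q.Monic) (α : R) :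
    (taylor α Q).nextCoeff = Q.nextCoeff + Q.natDegree * α := by
  rcases Nat.eq_zero_or_pos Q.natDegree with hd | hd
  · simp [hQ.natDegree_eq_zero.1 hd]
  have hH : (hasseDeriv (Q.natDegree - 1) Q).natDegree ≤ 1 :=
    (natDegree_hasseDeriv_le _ _).trans (by omega)
  rw [nextCoeff_of_natDegree_pos (by rwa [natDegree_taylor]), natDegree_taylor, taylor_coeff,
    eq_X_add_C_of_natDegree_le_one hH, nextCoeff_of_natDegree_pos hd]
  have hone : 1 + (Q.natDegree - 1) = Q.natDegree := by omega
  have hchoose : Q.natDegree.choose (Q.natDegree - 1) = Q.natDegree := by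
    rw [Nat.choose_symm (by omega), Nat.choose_one_right]
  simp [hasseDeriv_coeff, hone, hchoose, hQ.coeff_natDegree, add_comm]

theorem isDistinguishedAt_taylor {R : Type*} [CommRing R] {I : Ideal R} {Q : R[X]}
    (hQ : Q.IsDistinguishedAt I) {α : R} (hα : α ∈ I) : (taylor α Q).IsDistinguishedAt I := by
  have hmap : (taylor α Q).map (Ideal.Quotient.mk I) = Q.map (Ideal.Quotient.mk I) := by
    rw [map_taylor, Ideal.Quotient.eq_zero_iff_mem.2 hα, taylor_zero]
  refine ⟨⟨fun {i} hi => ?_⟩, by rw [Monic, leadingCoeff_taylor, hQ.monic]⟩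
  rw [natDegree_taylor] at hi
  rw [← Ideal.Quotient.eq_zero_iff_mem, ← coeff_map, hmap, coeff_map]
  exact Ideal.Quotient.eq_zero_iff_mem.2 (hQ.mem hi)

theorem exists_isDistinguishedAt_dvd_taylor {Q : (PowerSeries K)[X]}
    (hQ : Q.map PowerSeries.constantCoeff ≠ 0) (c : K) :
    ∃ f : (PowerSeries K)[X], f.IsDistinguishedAt (IsLocalRing.maximalIdeal (PowerSeries K)) ∧
      f.natDegree = (Q.map PowerSeries.constantCoeff).rootMultiplicity c ∧
      f ∣ taylor (PowerSeries.C c) Q := by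
  have hred : (taylor (PowerSeries.C c) Q).map PowerSeries.constantCoeff =
      taylor c (Q.map PowerSeries.constantCoeff) := by
    rw [map_taylor, PowerSeries.constantCoeff_C]
  have hmem (i : ℕ) : (taylor (PowerSeries.C c) Q).coeff i ∈ IsLocalRing.maximalIdeal _ ↔
      (taylor c (Q.map PowerSeries.constantCoeff)).coeff i = 0 := by
    rw [mem_maximalIdeal_iff_constantCoeff_eq_zero, ← hred, coeff_map]
  rw [rootMultiplicity_eq_natTrailingDegree, ← taylor_apply]
  refine exists_isDistinguishedAt_dvd (fun i hi => ?_) ?_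
  · rw [hmem, coeff_eq_zero_of_lt_natTrailingDegree hi]
  · rw [hmem]
    exact trailingCoeff_nonzero_iff_nonzero.2 ((taylor_eq_zero c _).not.2 hQ)

theorem exists_nextCoeff_taylor_eq_zero [CharZero K] {Q : (PowerSeries K)[X]}
    (hQ : Q.IsDistinguishedAt (IsLocalRing.maximalIdeal (PowerSeries K)))
    (hdeg : Q.natDegree ≠ 0) :
    ∃ α : PowerSeries K, (taylor α Q).nextCoeff = 0 ∧ PowerSeries.constantCoeff α = 0 := by
  refine ⟨PowerSeries.C (-(Q.natDegree : K)⁻¹) * Q.nextCoeff, ?_, ?_⟩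
  · rw [nextCoeff_taylor hQ.monic, ← mul_assoc, ← map_natCast PowerSeries.C, ← map_mul]
    simp [hdeg]
  · have hmem : Q.nextCoeff ∈ IsLocalRing.maximalIdeal (PowerSeries K) := by
      rw [nextCoeff_of_natDegree_pos (Nat.pos_of_ne_zero hdeg)]
      exact hQ.mem (Nat.sub_one_lt hdeg)
    rw [map_mul, mem_maximalIdeal_iff_constantCoeff_eq_zero.1 hmem, mul_zero]

theorem hasPuiseuxRoot_of_isDistinguishedAt [IsAlgClosed K] [CharZero K] {Q : (PowerSeries K)[X]}
    (hQ : Q.IsDistinguishedAt (IsLocalRing.maximalIdeal (PowerSeries K)))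
    (hdeg : Q.natDegree ≠ 0) : HasPuiseuxRoot Q := by
  induction hd : Q.natDegree using Nat.strong_induction_on generalizing Q with
  | _ d ih =>
  obtain ⟨α, hnext, hα⟩ := exists_nextCoeff_taylor_eq_zero hQ hdeg
  refine HasPuiseuxRoot.of_taylor ?_ hα
  have hQ₁ := isDistinguishedAt_taylor hQ (mem_maximalIdeal_iff_constantCoeff_eq_zero.2 hα)
  have hdeg₁ : (taylor α Q).natDegree = d := (natDegree_taylor Q α).trans hd
  by_cases hpow : taylor α Q = X ^ (taylor α Q).natDegree
  · refine hasPuiseuxRoot_of_isRoot (α := 0) ?_ (map_zero _)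
    rw [hpow, hdeg₁, IsRoot, eval_pow, eval_X, zero_pow (hd ▸ hdeg)]
  obtain ⟨M, hM, ν, hν, Q', hQ', hscale, hpow'⟩ := exists_scaleRoots_eq_map_expandHom hQ₁ hpow
  have hred := hQ'.map PowerSeries.constantCoeff
  have hdeg' : (Q'.map PowerSeries.constantCoeff).natDegree = d := by
    rw [hQ'.natDegree_map, ← natDegree_scaleRoots Q' (PowerSeries.X ^ ν), hscale,
      hQ₁.monic.natDegree_map, hdeg₁]
  have hnext' : (Q'.map PowerSeries.constantCoeff).nextCoeff = 0 := by
    have hmul : Q'.nextCoeff * PowerSeries.X ^ ν = 0 := by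
      rw [← nextCoeff_scaleRoots, hscale,
        nextCoeff_map_of_leadingCoeff_ne_zero _ (by simp [hQ₁.monic.leadingCoeff]), hnext, map_zero]
    rw [nextCoeff_map_of_leadingCoeff_ne_zero _ (by simp [hQ'.leadingCoeff]),
      (mul_eq_zero.1 hmul).resolve_right (pow_ne_zero _ PowerSeries.X_ne_zero), map_zero]
  -- The root `c` of the reduction is not its only root, so its multiplicity is less than `d`.
  obtain ⟨c, hc, hlt⟩ :=
    exists_isRoot_rootMultiplicity_lt hred hnext' (by rwa [hQ'.natDegree_map])
  obtain ⟨f, hf, hfdeg, hfdvd⟩ := exists_isDistinguishedAt_dvd_taylor hred.ne_zero c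
  have hfpos : f.natDegree ≠ 0 :=
    hfdeg ▸ ((rootMultiplicity_pos hred.ne_zero).2 hc).ne'
  exact .of_scaleRoots hM hν (.of_dvd (ih _ (by rwa [hfdeg, ← hdeg']) hf hfpos rfl) hfdvd) hscale

theorem hasPuiseuxRoot_of_isRoot_map [IsAlgClosed K] [CharZero K] {Q : (PowerSeries K)[X]}
    (hQ : Q.map PowerSeries.constantCoeff ≠ 0)
    (hroot : (Q.map PowerSeries.constantCoeff).IsRoot 0) : HasPuiseuxRoot Q := by
  obtain ⟨f, hf, hfdeg, hfdvd⟩ := exists_isDistinguishedAt_dvd_taylor hQ 0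
  rw [map_zero, taylor_zero] at hfdvd
  exact .of_dvd (hasPuiseuxRoot_of_isDistinguishedAt hf
    (hfdeg ▸ ((rootMultiplicity_pos hQ).2 hroot).ne')) hfdvd

end NewtonPuiseux

/-! ### Puiseux series as Hahn series -/

section PuiseuxSeries

theorem algebraMap_hahnSeries_eq_C {Γ : Type*} [Semiring Γ] [PartialOrder Γ]
    [IsStrictOrderedRing Γ] (c : K) : algebraMap K (HahnSeries Γ K) c = HahnSeries.C c := by
  rw [HahnSeries.algebraMap_apply', PowerSeries.algebraMap_apply, HahnSeries.ofPowerSeries_C]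
  rfl

/-- The inclusion of `K((t ^ (1 / N)))` in the field of Hahn series, with Laurent series written
in terms of `t ^ (1 / N)`. -/
def laurentHom (K : Type*) [Field K] {N : ℕ} (hN : 0 < N) : HahnSeries ℤ K →+* HahnSeries ℚ K :=
  HahnSeries.embDomainRingHom ((AddMonoidHom.mulRight (N : ℚ)⁻¹).comp (Int.castAddHom ℚ))
    ((mul_left_injective₀ (by positivity)).comp Int.cast_injective)
    fun a b => by
      have hinv : (0 : ℚ) < (N : ℚ)⁻¹ := by positivity
      simp [mul_le_mul_iff_of_pos_right hinv]

theorem laurentHom_single {N : ℕ} (hN : 0 < N) (m : ℤ) (c : K) :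
    laurentHom K hN (HahnSeries.single m c) = HahnSeries.single ((m : ℚ) * (N : ℚ)⁻¹) c :=
  HahnSeries.embDomain_single

theorem orderTop_laurentHom {N : ℕ} (hN : 0 < N) (z : HahnSeries ℤ K) :
    (laurentHom K hN z).orderTop = WithTop.map (fun m : ℤ => (m : ℚ) * (N : ℚ)⁻¹) z.orderTop :=
  HahnSeries.orderTop_embDomain

theorem isPuiseux_laurentHom {N : ℕ} (hN : 0 < N) (z : HahnSeries ℤ K) :
    IsPuiseux (laurentHom K hN z) := by
  refine ⟨N, hN, fun α hα => ?_⟩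
  obtain ⟨m, -, rfl⟩ := HahnSeries.support_embDomain_subset hα
  exact ⟨m, inv_mul_cancel_right₀ (by positivity) _⟩

/-- The inclusion of `K[[t ^ (1 / N)]]` in the field of Hahn series, with power series written in
terms of `t ^ (1 / N)`. -/
def powerSeriesHom (K : Type*) [Field K] {N : ℕ} (hN : 0 < N) :
    PowerSeries K →ₐ[K] HahnSeries ℚ K :=
  { (laurentHom K hN).comp (HahnSeries.ofPowerSeries ℤ K) with
    commutes' := fun c => by
      rw [algebraMap_hahnSeries_eq_C, PowerSeries.algebraMap_apply]
      exact (congrArg _ (HahnSeries.ofPowerSeries_C c)).trans HahnSeries.embDomainRingHom_C }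

theorem powerSeriesHom_apply {N : ℕ} (hN : 0 < N) (ψ : PowerSeries K) :
    powerSeriesHom K hN ψ = laurentHom K hN (HahnSeries.ofPowerSeries ℤ K ψ) := rfl

theorem powerSeriesHom_X_pow {N : ℕ} (hN : 0 < N) :
    powerSeriesHom K hN (PowerSeries.X ^ N) = HahnSeries.single 1 1 := by
  rw [powerSeriesHom_apply, HahnSeries.ofPowerSeries_X_pow, laurentHom_single, Int.cast_natCast,
    mul_inv_cancel₀ (by positivity)]

theorem orderTop_powerSeriesHom_pos {N : ℕ} (hN : 0 < N) {ψ : PowerSeries K}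
    (hψ : PowerSeries.constantCoeff ψ = 0) : 0 < (powerSeriesHom K hN ψ).orderTop := by
  rw [powerSeriesHom_apply, orderTop_laurentHom, HahnSeries.ofPowerSeries_apply,
    HahnSeries.orderTop_embDomain]
  cases hn : (HahnSeries.toPowerSeries.symm ψ).orderTop with
  | top => exact WithTop.coe_lt_top _
  | coe n =>
    have hcoeff : PowerSeries.coeff n ψ ≠ 0 := HahnSeries.coeff_orderTop_ne hn
    have hn0 : 0 < n := Nat.pos_of_ne_zero fun h0 => hcoeff (by rw [h0]; simpa using hψ)
    exact WithTop.coe_lt_coe.2 (mul_pos (Int.cast_pos.2 (Int.natCast_pos.2 hn0)) (by positivity))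

theorem isPuiseux_inv_powerSeriesHom {N : ℕ} (hN : 0 < N) (ψ : PowerSeries K) :
    IsPuiseux (powerSeriesHom K hN ψ)⁻¹ := by
  rw [powerSeriesHom_apply, ← map_inv₀]
  exact isPuiseux_laurentHom hN _

end PuiseuxSeries

/-! ### Specialization to a point of the projective line -/

section Near

open Polynomial

variable {L : Type*} [Field L] [Algebra K L] {Γ₀ : Type*} [LinearOrderedCommGroupWithZero Γ₀]
  {v : Valuation L Γ₀} {s : OnePoint K} {u : L}

/-- The element `u` of an extension field specializes to the point `s` of `P¹(K)` along the
valuation `v`, without being equal to `s`. -/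
def Near (v : Valuation L Γ₀) (s : OnePoint K) (u : L) : Prop :=
  match s with
  | ∞ => 1 < v u
  | (a : K) => u ≠ algebraMap K L a ∧ v (u - algebraMap K L a) < 1

theorem near_infty : Near v (∞ : OnePoint K) u ↔ 1 < v u := Iff.rfl

theorem near_coe {a : K} :
    Near v (a : OnePoint K) u ↔ u ≠ algebraMap K L a ∧ v (u - algebraMap K L a) < 1 := Iff.rfl

variable [v.IsTrivialOn K]

theorem transcendental_of_one_lt_valuation (h : 1 < v u) : Transcendental K u :=
  v.transcendental_of_ne_one K u (v.pos_iff.1 (zero_lt_one.trans h)) h.ne'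

theorem Near.transcendental (h : Near v s u) : Transcendental K u := by
  induction s using OnePoint.rec with
  | infty => exact transcendental_of_one_lt_valuation h
  | coe a =>
    intro hu
    exact v.transcendental_of_ne_one K _ (sub_ne_zero.2 h.1) h.2.ne
      (hu.sub (isAlgebraic_algebraMap a))

theorem valuation_aeval_eq_pow_natTrailingDegree (hu₀ : u ≠ 0) (hu : v u < 1) {q : K[X]}
    (hq : q ≠ 0) : v (aeval u q) = v u ^ q.natTrailingDegree := by
  have hrev : v (aeval u⁻¹ q.reverse) = v u⁻¹ ^ q.reverse.natDegree :=
    valuation_aeval_eq_valuation_X_pow_natDegree_of_one_lt_valuation_X _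
      (by rwa [map_inv₀, one_lt_inv₀ (v.pos_iff.2 hu₀)]) (reverse_eq_zero.not.2 hq)
  let _ := invertibleOfNonzero hu₀
  rw [aeval_def, ← eval₂_reverse_mul_pow, map_mul, invOf_eq_inv, ← aeval_def, hrev, map_pow,
    map_inv₀, reverse_natDegree, inv_pow, inv_mul_eq_iff_eq_mul₀, ← pow_add,
    Nat.sub_add_cancel q.natTrailingDegree_le_natDegree]
  exact pow_ne_zero _ (v.ne_zero_iff.2 hu₀)

theorem poleMult_zero (s : OnePoint K) : poleMult s (0 : RatFunc K) = 0 := by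
  induction s using OnePoint.rec <;> simp [poleMult]

section Eval

variable {L : Type w} [Field L] [Algebra K L] {v : Valuation L Γ₀} [v.IsTrivialOn K] {u : L}

theorem Near.exists_valuation_eval_eq_zpow (h : Near v s u) :
    ∃ γ : Γ₀, 1 < γ ∧ ∀ f : RatFunc K, f ≠ 0 →
      v (f.eval (algebraMap K L) u) = γ ^ poleMult s f := by
  induction s using OnePoint.rec with
  | infty =>
    refine ⟨v u, h, fun f hf => ?_⟩
    have hval {q : K[X]} (hq : q ≠ 0) : v (aeval u q) = v u ^ q.natDegree :=
      valuation_aeval_eq_valuation_X_pow_natDegree_of_one_lt_valuation_X u h hq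
    rw [RatFunc.eval, ← aeval_def, ← aeval_def, map_div₀, hval (RatFunc.num_ne_zero hf),
      hval f.denom_ne_zero, ← zpow_natCast, ← zpow_natCast,
      ← zpow_sub₀ (zero_lt_one.trans h).ne']
    rfl
  | coe a =>
    obtain ⟨hua, hlt⟩ := h
    have hpos : 0 < v (u - algebraMap K L a) := v.pos_iff.2 (sub_ne_zero.2 hua)
    refine ⟨(v (u - algebraMap K L a))⁻¹, (one_lt_inv₀ hpos).2 hlt, fun f hf => ?_⟩
    have hval {q : K[X]} (hq : q ≠ 0) :
        v (aeval u q) = v (u - algebraMap K L a) ^ q.rootMultiplicity a := by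
      have htaylor : aeval u q = aeval (u - algebraMap K L a) (taylor a q) := by
        simp [taylor_apply, aeval_comp]
      rw [htaylor, rootMultiplicity_eq_natTrailingDegree, ← taylor_apply]
      exact valuation_aeval_eq_pow_natTrailingDegree (sub_ne_zero.2 hua) hlt
        ((taylor_eq_zero a q).not.2 hq)
    rw [RatFunc.eval, ← aeval_def, ← aeval_def, map_div₀, hval (RatFunc.num_ne_zero hf),
      hval f.denom_ne_zero, ← zpow_natCast, ← zpow_natCast, ← zpow_sub₀ hpos.ne', inv_zpow',
      ← neg_sub]
    simp [poleMult]

theorem Near.one_lt_valuation_eval_iff (h : Near v s u) (f : RatFunc K) :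
    1 < v (f.eval (algebraMap K L) u) ↔ IsUnivPole f s := by
  rcases eq_or_ne f 0 with rfl | hf
  · simp [IsUnivPole, poleMult_zero]
  · obtain ⟨γ, hγ, hval⟩ := h.exists_valuation_eval_eq_zpow
    rw [hval f hf, one_lt_zpow_iff_right₀ hγ, IsUnivPole]

end Eval

end Near

section Moebius

variable {L : Type*} [Field L] [Algebra K L] {Γ₀ : Type*} [LinearOrderedCommGroupWithZero Γ₀]
  {v : Valuation L Γ₀}

/-- The fractional linear expression `(a z + b) / (c z + d)` in an element `z` of an extension
field. -/
def moebiusAt (A : GL (Fin 2) K) (z : L) : L :=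
  (algebraMap K L (A.1 0 0) * z + algebraMap K L (A.1 0 1)) /
    (algebraMap K L (A.1 1 0) * z + algebraMap K L (A.1 1 1))

theorem moebiusAt_denominator_ne_zero (A : GL (Fin 2) K) {z : L} (hz : Transcendental K z) :
    algebraMap K L (A.1 1 0) * z + algebraMap K L (A.1 1 1) ≠ 0 := by
  intro h
  have hlin : Polynomial.aeval z
      (Polynomial.C (A.1 1 0) * Polynomial.X + Polynomial.C (A.1 1 1)) = 0 := by simpa using h
  have hlin₀ := (transcendental_iff.1 hz) _ hlin
  have h0 : A.1 1 1 = 0 := by simpa using congrArg (Polynomial.coeff · 0) hlin₀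
  have h1 : A.1 1 0 = 0 := by simpa using congrArg (Polynomial.coeff · 1) hlin₀
  exact A.det_ne_zero (by rw [Matrix.det_fin_two, h0, h1, mul_zero, mul_zero, sub_zero])

variable [v.IsTrivialOn K]

theorem valuation_linear_eq {a : K} (ha : a ≠ 0) (b : K) {z : L} (hz : 1 < v z) :
    v (algebraMap K L a * z + algebraMap K L b) = v z := by
  have haz : v (algebraMap K L a * z) = v z := by
    rw [map_mul, Valuation.IsTrivialOn.eq_one a ha, one_mul]
  rw [v.map_add_eq_of_lt_left, haz]
  exact (Valuation.IsTrivialOn.valuation_algebraMap_le_one v b).trans_lt (haz ▸ hz)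

open Classical in
theorem near_smul_infty_moebiusAt (A : GL (Fin 2) K) {z : L} (hz : 1 < v z) :
    Near v (A • (∞ : OnePoint K)) (moebiusAt A z) := by
  have hdet : A.1 0 0 * A.1 1 1 - A.1 0 1 * A.1 1 0 ≠ 0 := by
    rw [← Matrix.det_fin_two]
    exact A.det_ne_zero
  have hden := moebiusAt_denominator_ne_zero A (transcendental_of_one_lt_valuation hz)
  rw [OnePoint.smul_infty_eq_ite]
  change Near v (if A.1 1 0 = 0 then ∞ else ((A.1 0 0 / A.1 1 0 : K) : OnePoint K)) _
  split_ifs with hc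
  · rw [hc, mul_zero, sub_zero, mul_ne_zero_iff] at hdet
    rw [near_infty, moebiusAt, map_div₀, valuation_linear_eq hdet.1 _ hz, hc, map_zero, zero_mul,
      zero_add, Valuation.IsTrivialOn.eq_one _ hdet.2, div_one]
    exact hz
  · have hc' : algebraMap K L (A.1 1 0) ≠ 0 := (map_ne_zero _).2 hc
    have hsub : moebiusAt A z - algebraMap K L (A.1 0 0 / A.1 1 0) =
        algebraMap K L (-(A.1 0 0 * A.1 1 1 - A.1 0 1 * A.1 1 0) / A.1 1 0) /
          (algebraMap K L (A.1 1 0) * z + algebraMap K L (A.1 1 1)) := by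
      rw [moebiusAt, map_div₀, map_div₀, div_sub_div _ _ hden hc', div_div]
      congr 1
      · simp only [map_neg, map_sub, map_mul]
        ring
      · ring
    have hnum := div_ne_zero (neg_ne_zero.2 hdet) hc
    refine near_coe.2 ⟨sub_ne_zero.1 ?_, ?_⟩ <;> rw [hsub]
    · exact div_ne_zero ((map_ne_zero _).2 hnum) hden
    · rw [map_div₀ v, valuation_linear_eq hc _ hz, Valuation.IsTrivialOn.eq_one _ hnum, one_div]
      exact inv_lt_one_of_one_lt₀ hz

open Classical in
theorem near_moebiusAt_inv {A : GL (Fin 2) K} {s : OnePoint K} (hA : A • s = ∞) {z : L}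
    (hz : 1 < v z) : Near v s (moebiusAt A⁻¹ z) := by
  rw [← inv_smul_eq_iff.2 hA.symm]
  exact near_smul_infty_moebiusAt A⁻¹ hz

end Moebius

section HahnValuation

/-- The valuation of the field of Hahn series with rational exponents for which `1 < v φ` means
that the leading exponent of `φ` is negative. -/
def hahnVal (K : Type*) [Field K] :
    Valuation (HahnSeries ℚ K) (Multiplicative (WithTop ℚ)ᵒᵈ) :=
  AddValuation.toValuation (HahnSeries.addVal ℚ K)

theorem hahnVal_lt_one_iff {φ : HahnSeries ℚ K} : hahnVal K φ < 1 ↔ 0 < φ.orderTop := Iff.rfl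

theorem one_lt_hahnVal_iff {φ : HahnSeries ℚ K} : 1 < hahnVal K φ ↔ φ.orderTop < 0 := Iff.rfl

instance : (hahnVal K).IsTrivialOn K where
  eq_one c hc := by
    rw [algebraMap_hahnSeries_eq_C]
    exact congrArg (fun a => Multiplicative.ofAdd (OrderDual.toDual a))
      (HahnSeries.orderTop_single (Γ := ℚ) (a := 0) hc)

theorem serDeg_pos_iff {φ : HahnSeries ℚ K} : 0 < serDeg φ ↔ 1 < hahnVal K φ := by
  rcases eq_or_ne φ 0 with rfl | hφ
  · simp [serDeg]
  · rw [serDeg, neg_pos, one_lt_hahnVal_iff, ← HahnSeries.order_eq_orderTop_of_ne_zero hφ,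
      ← WithTop.coe_zero, WithTop.coe_lt_coe]

theorem one_lt_hahnVal_serX : 1 < hahnVal K (serX K) := by
  rw [one_lt_hahnVal_iff, serX, HahnSeries.orderTop_single one_ne_zero]
  exact WithTop.coe_lt_coe.2 (by norm_num)

theorem hahnVal_powerSeriesHom_lt_one {N : ℕ} (hN : 0 < N) {ψ : PowerSeries K}
    (hψ : PowerSeries.constantCoeff ψ = 0) : hahnVal K (powerSeriesHom K hN ψ) < 1 :=
  hahnVal_lt_one_iff.2 (orderTop_powerSeriesHom_pos hN hψ)

end HahnValuation

/-! ### Values of rational functions in extension fields -/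

section HasValue

variable {R F L : Type*} [CommRing R] [Algebra K R] [Field F] [Algebra R F]
  [Field L] [Algebra K L] {φ : R →ₐ[K] L} {r r' : F} {z z' : L}

/-- The element `r` of the fraction field of `R` is defined at the homomorphism `φ`, i.e. it is a
fraction whose denominator `φ` does not annihilate, and has the value `z` there. -/
def HasValue (φ : R →ₐ[K] L) (r : F) (z : L) : Prop :=
  ∃ a b : R, φ b ≠ 0 ∧ r * algebraMap R F b = algebraMap R F a ∧ z * φ b = φ a

theorem hasValue_algebraMap (φ : R →ₐ[K] L) (a : R) : HasValue φ (algebraMap R F a) (φ a) :=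
  ⟨a, 1, by simp, by simp, by simp⟩

theorem HasValue.add (h : HasValue φ r z) (h' : HasValue φ r' z') :
    HasValue φ (r + r') (z + z') := by
  obtain ⟨a, b, hb, hr, hz⟩ := h
  obtain ⟨a', b', hb', hr', hz'⟩ := h'
  refine ⟨a * b' + a' * b, b * b', by simp [hb, hb'], ?_, ?_⟩
  · simp only [map_add, map_mul, ← hr, ← hr']
    ring
  · simp only [map_add, map_mul, ← hz, ← hz']
    ring

theorem HasValue.mul (h : HasValue φ r z) (h' : HasValue φ r' z') :
    HasValue φ (r * r') (z * z') := by
  obtain ⟨a, b, hb, hr, hz⟩ := h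
  obtain ⟨a', b', hb', hr', hz'⟩ := h'
  refine ⟨a * a', b * b', by simp [hb, hb'], ?_, ?_⟩
  · simp only [map_mul, ← hr, ← hr']
    ring
  · simp only [map_mul, ← hz, ← hz']
    ring

theorem HasValue.neg (h : HasValue φ r z) : HasValue φ (-r) (-z) := by
  obtain ⟨a, b, hb, hr, hz⟩ := h
  exact ⟨-a, b, hb, by rw [neg_mul, hr, map_neg], by rw [neg_mul, hz, map_neg]⟩

theorem HasValue.sub (h : HasValue φ r z) (h' : HasValue φ r' z') :
    HasValue φ (r - r') (z - z') := by
  rw [sub_eq_add_neg, sub_eq_add_neg]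
  exact h.add h'.neg

section Scalar

variable [Algebra K F] [IsScalarTower K R F]

theorem hasValue_const (φ : R →ₐ[K] L) (c : K) :
    HasValue φ (algebraMap K F c) (algebraMap K L c) := by
  rw [IsScalarTower.algebraMap_apply K R F, ← φ.commutes]
  exact hasValue_algebraMap φ _

theorem HasValue.polynomial_aeval (h : HasValue φ r z) (q : Polynomial K) :
    HasValue φ (Polynomial.aeval r q) (Polynomial.aeval z q) := by
  induction q using Polynomial.induction_on with
  | C c => simpa using hasValue_const φ c
  | add a b ha hb => simpa using ha.add hb
  | monomial n c hn =>
    simp only [pow_succ, ← mul_assoc, map_mul _ _ Polynomial.X, Polynomial.aeval_X]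
    exact hn.mul h

theorem HasValue.mvPolynomial_aeval {σ : Type*} {a : σ → F} {b : σ → L}
    (h : ∀ i, HasValue φ (a i) (b i)) (q : MvPolynomial σ K) :
    HasValue φ (MvPolynomial.aeval a q) (MvPolynomial.aeval b q) := by
  induction q using MvPolynomial.induction_on with
  | C c => simpa using hasValue_const φ c
  | add a b ha hb => simpa using ha.add hb
  | mul_X q i hq =>
    rw [map_mul, map_mul, MvPolynomial.aeval_X, MvPolynomial.aeval_X]
    exact hq.mul (h i)

end Scalar

variable [IsFractionRing R F]

theorem HasValue.inv (h : HasValue φ r z) (hz : z ≠ 0) : HasValue φ r⁻¹ z⁻¹ := by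
  obtain ⟨a, b, hb, hr, hab⟩ := h
  have ha : φ a ≠ 0 := hab ▸ mul_ne_zero hz hb
  have hr₀ : r ≠ 0 := by
    rintro rfl
    rw [zero_mul, eq_comm, map_eq_zero_iff _ (IsFractionRing.injective R F)] at hr
    exact ha (hr ▸ map_zero φ)
  exact ⟨b, a, ha, by rw [← hr, inv_mul_cancel_left₀ hr₀], by rw [← hab, inv_mul_cancel_left₀ hz]⟩

theorem HasValue.div (h : HasValue φ r z) (h' : HasValue φ r' z') (hz : z' ≠ 0) :
    HasValue φ (r / r') (z / z') := by
  rw [div_eq_mul_inv, div_eq_mul_inv]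
  exact h.mul (h'.inv hz)

theorem HasValue.unique (h : HasValue φ r z) (h' : HasValue φ r z') : z = z' := by
  obtain ⟨a, b, hb, hr, hz⟩ := h
  obtain ⟨a', b', hb', hr', hz'⟩ := h'
  have hcross : a * b' = a' * b := by
    apply IsFractionRing.injective R F
    rw [map_mul, map_mul, ← hr, ← hr', mul_right_comm]
  have hcross' := congrArg φ hcross
  rw [map_mul, map_mul, ← hz, ← hz', mul_right_comm z'] at hcross'
  exact mul_right_cancel₀ hb (mul_right_cancel₀ hb' hcross')

variable [IsDomain R] [UniqueFactorizationMonoid R]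

theorem mul_algebraMap_den (r : F) :
    r * algebraMap R F (IsFractionRing.den R r) = algebraMap R F (IsFractionRing.num R r) :=
  IsFractionRing.num_mul_den_eq_num_iff_eq.2 rfl

theorem hasValue_num_div_den (h : φ (IsFractionRing.den R r) ≠ 0) :
    HasValue φ r (φ (IsFractionRing.num R r) / φ (IsFractionRing.den R r)) :=
  ⟨IsFractionRing.num R r, IsFractionRing.den R r, h, mul_algebraMap_den r, div_mul_cancel₀ _ h⟩

theorem HasValue.den_ne_zero (h : HasValue φ r z) : φ (IsFractionRing.den R r) ≠ 0 := by
  obtain ⟨a, b, hb, hr, -⟩ := h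
  have hcross : IsFractionRing.num R r * b = a * (IsFractionRing.den R r : R) := by
    apply IsFractionRing.injective R F
    rw [map_mul, map_mul, ← hr, ← mul_algebraMap_den, mul_right_comm]
  obtain ⟨c, rfl⟩ : (IsFractionRing.den R r : R) ∣ b :=
    (IsFractionRing.num_den_reduced R r).symm.dvd_of_dvd_mul_left (hcross ▸ dvd_mul_left _ _)
  rw [map_mul] at hb
  exact left_ne_zero_of_mul hb

end HasValue

section EvalRat

open MvPolynomial

variable {L : Type*} [Field L] [Algebra K L] {u v z : L} {r : RatFun K}

theorem hasValue_evalRat (h : aeval ![u, v] (IsFractionRing.den (Poly2 K) r : Poly2 K) ≠ 0) :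
    HasValue (aeval (R := K) ![u, v]) r (evalRat u v r) :=
  hasValue_num_div_den h

theorem HasValue.evalRat_eq (h : HasValue (aeval (R := K) ![u, v]) r z) : evalRat u v r = z :=
  (hasValue_evalRat h.den_ne_zero).unique h

theorem hasValue_algebraMap_X (a : Fin 2 → L) (i : Fin 2) :
    HasValue (aeval (R := K) a) (algebraMap (Poly2 K) (RatFun K) (X i)) (a i) := by
  simpa using hasValue_algebraMap (F := RatFun K) (aeval a) (X i)

theorem hasValue_moebius (A : GL (Fin 2) K) {a : Fin 2 → L} {i : Fin 2}
    (h : Transcendental K (a i)) : HasValue (aeval (R := K) a) (moebius A i) (moebiusAt A (a i)) :=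
  have hlinear (c d : K) := ((hasValue_const _ c).mul (hasValue_algebraMap_X a i)).add
    (hasValue_const _ d)
  (hlinear _ _).div (hlinear _ _) (moebiusAt_denominator_ne_zero A h)

theorem hasValue_moebius_pair (A B : GL (Fin 2) K) (hu : Transcendental K u)
    (hv : Transcendental K v) (i : Fin 2) :
    HasValue (aeval (R := K) ![u, v]) (![moebius A 0, moebius B 1] i)
      (![moebiusAt A u, moebiusAt B v] i) :=
  Fin.cases (hasValue_moebius (i := 0) A hu)
    (fun j => by rw [Subsingleton.elim j 0]; exact hasValue_moebius (i := 1) B hv) i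

theorem hasValue_ratComp (A B : GL (Fin 2) K) (hu : Transcendental K u)
    (hv : Transcendental K v) (h : HasValue (aeval (R := K) ![moebiusAt A u, moebiusAt B v]) r z) :
    HasValue (aeval (R := K) ![u, v]) (ratComp r A B) z := by
  have hcomp := HasValue.mvPolynomial_aeval (hasValue_moebius_pair A B hu hv)
  have hz : z = evalRat (moebiusAt A u) (moebiusAt B v) r := h.evalRat_eq.symm
  exact hz ▸ (hcomp _).div (hcomp _) h.den_ne_zero

theorem aeval_polyComp_eq_zero_iff (p : Poly2 K) (A B : GL (Fin 2) K) (hu : Transcendental K u)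
    (hv : Transcendental K v) :
    aeval ![u, v] (polyComp p A B) = 0 ↔ aeval ![moebiusAt A u, moebiusAt B v] p = 0 := by
  have h := HasValue.mvPolynomial_aeval (hasValue_moebius_pair A B hu hv) p
  rw [← h.evalRat_eq, evalRat, div_eq_zero_iff, or_iff_left h.den_ne_zero, polyComp]

end EvalRat

section EvalEmbed

variable {L : Type w} [Field L] [Algebra K L]

theorem hasValue_embed {a : Fin 2 → L} {i : Fin 2} (h : Transcendental K (a i)) (f : RatFunc K) :
    HasValue (MvPolynomial.aeval (R := K) a) (embed i f) (f.eval (algebraMap K L) (a i)) :=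
  have hX := hasValue_algebraMap_X a i
  (hX.polynomial_aeval f.num).div (hX.polynomial_aeval f.denom) fun h0 =>
    f.denom_ne_zero (transcendental_iff.1 h _ h0)

end EvalEmbed

section CommonZeros

variable {L : Type*} [Field L]

theorem dvd_of_aeval_eq_zero_of_irreducible {R : Type*} [CommRing R] [IsDomain R]
    [IsGCDMonoid R] [Algebra R L] [FaithfulSMul R L] {P Q : Polynomial R} (hP : Irreducible P)
    (hdeg : P.natDegree ≠ 0) {u : L} (hPu : Polynomial.aeval u P = 0)
    (hQu : Polynomial.aeval u Q = 0) : P ∣ Q := by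
  let _ : Algebra (FractionRing R) L := FractionRing.liftAlgebra R L
  have hprim : P.IsPrimitive := hP.isPrimitive hdeg
  have hirr : Irreducible (P.map (algebraMap R (FractionRing R))) :=
    hprim.irreducible_iff_irreducible_map_fraction_map.1 hP
  have hmin {T : Polynomial R} (hT : Polynomial.aeval u T = 0) :
      minpoly (FractionRing R) u ∣ T.map (algebraMap R (FractionRing R)) :=
    minpoly.dvd _ _ (by rwa [Polynomial.aeval_map_algebraMap])
  have hint : IsIntegral (FractionRing R) u :=
    isAlgebraic_iff_isIntegral.1 ⟨_, hirr.ne_zero, by rwa [Polynomial.aeval_map_algebraMap]⟩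
  exact hprim.dvd_of_fraction_map_dvd_fraction_map
    (((minpoly.irreducible hint).dvd_symm hirr (hmin hPu)).trans (hmin hQu))

theorem aeval_cons_eq_eval₂_finSuccEquiv [Algebra K L] {n : ℕ} (u : L) (b : Fin n → L)
    (q : MvPolynomial (Fin (n + 1)) K) :
    MvPolynomial.aeval (Fin.cons u b : Fin (n + 1) → L) q =
      (MvPolynomial.finSuccEquiv K n q).eval₂ (MvPolynomial.aeval b : _ →ₐ[K] L) u := by
  induction q using MvPolynomial.induction_on with
  | C c => simp [MvPolynomial.finSuccEquiv_apply]
  | add a b ha hb => simp only [map_add, Polynomial.eval₂_add, ha, hb]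
  | mul_X a i ha =>
    rw [map_mul, map_mul, Polynomial.eval₂_mul, ha]
    refine Fin.cases ?_ (fun j => ?_) i <;>
      simp [MvPolynomial.finSuccEquiv_X_zero, MvPolynomial.finSuccEquiv_X_succ]

theorem dvd_of_aeval_cons_eq_zero [Algebra K L] {n : ℕ} {p q : MvPolynomial (Fin (n + 1)) K}
    (hp : Irreducible p) (hdeg : p.degreeOf 0 ≠ 0) {u : L} {b : Fin n → L}
    (hb : AlgebraicIndependent K b)
    (hpu : MvPolynomial.aeval (Fin.cons u b : Fin (n + 1) → L) p = 0)
    (hqu : MvPolynomial.aeval (Fin.cons u b : Fin (n + 1) → L) q = 0) : p ∣ q := by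
  let _ : Algebra (MvPolynomial (Fin n) K) L := (MvPolynomial.aeval b).toAlgebra
  have _ : FaithfulSMul (MvPolynomial (Fin n) K) L :=
    (faithfulSMul_iff_algebraMap_injective _ _).2 hb
  rw [aeval_cons_eq_eval₂_finSuccEquiv] at hpu hqu
  rw [← map_dvd_iff (MvPolynomial.finSuccEquiv K n)]
  exact dvd_of_aeval_eq_zero_of_irreducible ((MulEquiv.irreducible_iff _).2 hp)
    (by rwa [MvPolynomial.natDegree_finSuccEquiv]) hpu hqu

end CommonZeros

section SepSet

variable {L : Type w} [Field L] [Algebra K L] {u v : L} {p : Poly2 K} {r : RatFun K}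
  {f g : RatFunc K}

theorem hasValue_of_mem_localRing (hp : Irreducible p) (hpx : p.degreeOf 0 ≠ 0)
    (hv : Transcendental K v) (h : MvPolynomial.aeval ![u, v] p = 0) (hr : r ∈ localRing p) :
    HasValue (MvPolynomial.aeval (R := K) ![u, v]) r (evalRat u v r) :=
  hasValue_evalRat fun h0 => hr <|
    dvd_of_aeval_cons_eq_zero hp hpx (algebraicIndependent_unique_type_iff.2 hv) h h0

theorem hasValue_zero_of_mem_localIdeal (hp : Irreducible p) (hpx : p.degreeOf 0 ≠ 0)
    (hv : Transcendental K v) (h : MvPolynomial.aeval ![u, v] p = 0) (hr : r ∈ localIdeal p) :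
    HasValue (MvPolynomial.aeval (R := K) ![u, v]) r 0 := by
  obtain ⟨q, hq, rfl⟩ := hr
  have hmul := (hasValue_of_mem_localRing hp hpx hv h hq).mul (hasValue_algebraMap _ p)
  rwa [h, mul_zero] at hmul

theorem hasValue_eval_sub_eval (hp : Irreducible p) (hpx : p.degreeOf 0 ≠ 0)
    (hfg : (f, g) ∈ sepSet r p) (hu : Transcendental K u) (hv : Transcendental K v)
    (h : MvPolynomial.aeval ![u, v] p = 0) :
    HasValue (MvPolynomial.aeval (R := K) ![u, v]) r
      (f.eval (algebraMap K L) u - g.eval (algebraMap K L) v) := by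
  have hf := hasValue_embed (a := ![u, v]) (i := 0) hu f
  have hg := hasValue_embed (a := ![u, v]) (i := 1) hv g
  have hr := (hf.sub hg).sub (hasValue_zero_of_mem_localIdeal hp hpx hv h hfg)
  rwa [sub_sub_cancel, sub_zero] at hr

theorem evalRat_ratComp (hp : Irreducible p) (hpx : p.degreeOf 0 ≠ 0)
    (hfg : (f, g) ∈ sepSet r p) (A B : GL (Fin 2) K) (hu : Transcendental K u)
    (hv : Transcendental K v) (hAu : Transcendental K (moebiusAt A u))
    (hBv : Transcendental K (moebiusAt B v))
    (h : MvPolynomial.aeval ![moebiusAt A u, moebiusAt B v] p = 0) :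
    evalRat u v (ratComp r A B) =
      f.eval (algebraMap K L) (moebiusAt A u) - g.eval (algebraMap K L) (moebiusAt B v) :=
  (hasValue_ratComp A B hu hv (hasValue_eval_sub_eval hp hpx hfg hAu hBv h)).evalRat_eq

theorem IsPole.isUnivPole_or (hp : Irreducible p) (hpx : p.degreeOf 0 ≠ 0)
    (hfg : (f, g) ∈ sepSet r p) {s : Pt K} (h : IsPole r p s) :
    IsUnivPole f s.1 ∨ IsUnivPole g s.2 := by
  classical
  obtain ⟨-, A, B, hA, hB, -, φ, -, hzero, hφ, hpos⟩ := h
  rw [serDeg_pos_iff] at hφ hpos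
  have hnear₁ := near_moebiusAt_inv hA (one_lt_hahnVal_serX (K := K))
  have hnear₂ := near_moebiusAt_inv hB hφ
  have hx := transcendental_of_one_lt_valuation (one_lt_hahnVal_serX (K := K)) (K := K)
  have hy := transcendental_of_one_lt_valuation (K := K) hφ
  rw [aeval_polyComp_eq_zero_iff p _ _ hx hy] at hzero
  rw [evalRat_ratComp hp hpx hfg _ _ hx hy hnear₁.transcendental hnear₂.transcendental hzero]
    at hpos
  rw [← hnear₁.one_lt_valuation_eval_iff, ← hnear₂.one_lt_valuation_eval_iff, ← lt_max_iff]
  exact hpos.trans_le (Valuation.map_sub _ _ _)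

end SepSet

/-! ### Points and branches of the curve -/

section BiHom

open MvPolynomial

variable {p : Poly2 K}

theorem aeval_biHom {R : Type*} [CommRing R] [Algebra K R] (p : Poly2 K) (a b : Fin 2 → R) :
    aeval (Sum.elim a b) (biHom p) = ∑ m ∈ p.support, algebraMap K R (p.coeff m) *
      (a 0 ^ (p.degreeOf 0 - m 0) * a 1 ^ m 0) * (b 0 ^ (p.degreeOf 1 - m 1) * b 1 ^ m 1) := by
  simp only [biHom, map_sum, map_mul, map_pow, aeval_X, aeval_C, Sum.elim_inl, Sum.elim_inr]

theorem degreeOf_rename_swap (p : Poly2 K) (i : Fin 2) :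
    (rename (Equiv.swap 0 1) p).degreeOf i = p.degreeOf (Equiv.swap 0 1 i) := by
  have h := degreeOf_rename_of_injective (p := p) (Equiv.swap (0 : Fin 2) 1).injective
    (Equiv.swap 0 1 i)
  rwa [Equiv.swap_apply_self] at h

theorem aeval_biHom_rename_swap {R : Type*} [CommRing R] [Algebra K R] (p : Poly2 K)
    (a b : Fin 2 → R) :
    aeval (Sum.elim a b) (biHom (rename (Equiv.swap 0 1) p)) =
      aeval (Sum.elim b a) (biHom p) := by
  classical
  have hinj := (Equiv.swap (0 : Fin 2) 1).injective
  have hswap (m : Fin 2 →₀ ℕ) (i : Fin 2) :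
      m.mapDomain (Equiv.swap 0 1) i = m (Equiv.swap 0 1 i) := by
    simp
  rw [aeval_biHom, aeval_biHom, support_rename_of_injective hinj,
    Finset.sum_image (Finsupp.mapDomain_injective hinj).injOn]
  simp only [coeff_rename_mapDomain _ hinj, degreeOf_rename_swap, hswap, Equiv.swap_apply_left,
    Equiv.swap_apply_right, mul_right_comm]

theorem irreducible_rename_swap (hp : Irreducible p) :
    Irreducible (rename (Equiv.swap 0 1) p) :=
  (MulEquiv.irreducible_iff (renameEquiv K (Equiv.swap (0 : Fin 2) 1))).2 hp

variable {L : Type*} [Field L] [Algebra K L]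

theorem pow_sub_mul_pow_eq {x : L} (hx : x ≠ 0) (y : L) {m d : ℕ} (h : m ≤ d) :
    x ^ (d - m) * y ^ m = x ^ d * (y / x) ^ m := by
  rw [div_pow, mul_div_left_comm, pow_sub₀ x hx h, div_eq_mul_inv, mul_comm]

theorem aeval_biHom_of_ne_zero {a b : Fin 2 → L} (ha : a 0 ≠ 0) (hb : b 0 ≠ 0) :
    aeval (Sum.elim a b) (biHom p) =
      a 0 ^ p.degreeOf 0 * b 0 ^ p.degreeOf 1 * aeval ![a 1 / a 0, b 1 / b 0] p := by
  rw [aeval_biHom, aeval_def, eval₂_eq', Finset.mul_sum]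
  refine Finset.sum_congr rfl fun m hm => ?_
  rw [pow_sub_mul_pow_eq ha _ (monomial_le_degreeOf 0 hm),
    pow_sub_mul_pow_eq hb _ (monomial_le_degreeOf 1 hm), Fin.prod_univ_two]
  simp only [Matrix.cons_val_zero, Matrix.cons_val_one]
  ring

theorem aeval_algebraMap_ne_zero (hp : Irreducible p) (hpx : p.degreeOf 0 ≠ 0)
    (hpy : p.degreeOf 1 ≠ 0) (c : K) {t : L} (ht : Transcendental K t) :
    aeval ![algebraMap K L c, t] p ≠ 0 := by
  intro h
  obtain ⟨q, hq⟩ : p ∣ X 0 - C c :=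
    dvd_of_aeval_cons_eq_zero hp hpx (algebraicIndependent_unique_type_iff.2 ht) h (by simp)
  have hlin : (X 0 - C c : Poly2 K) ≠ 0 := fun h0 => by
    simpa using congrArg (eval fun _ => c + 1) h0
  have hle : p.degreeOf 1 ≤ (X 0 - C c : Poly2 K).degreeOf 1 := by
    rw [hq] at hlin ⊢
    rw [degreeOf_mul_eq (left_ne_zero_of_mul hlin) (right_ne_zero_of_mul hlin)]
    exact Nat.le_add_right _ _
  refine hpy (Nat.le_zero.1 (hle.trans ((degreeOf_sub_le _ _ _).trans ?_)))
  simp [degreeOf_X]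

/-- The coefficient of the highest power of `x` in `p`, as a polynomial in `y`. -/
def leadingCoeffX (p : Poly2 K) : Polynomial K :=
  ∑ m ∈ p.support with m 0 = p.degreeOf 0, Polynomial.monomial (m 1) (p.coeff m)

theorem leadingCoeffX_ne_zero (hp : p ≠ 0) : leadingCoeffX p ≠ 0 := by
  classical
  obtain ⟨M, hM, hMdeg⟩ := Finset.exists_mem_eq_sup p.support (support_nonempty.2 hp) (· 0)
  rw [← degreeOf_eq_sup] at hMdeg
  intro h
  have hcoeff := congrArg (Polynomial.coeff · (M 1)) h
  simp only [leadingCoeffX, Polynomial.finsetSum_coeff, Polynomial.coeff_monomial] at hcoeff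
  rw [Finset.sum_eq_single M _ fun hnot => (hnot (by simp [hM, hMdeg])).elim] at hcoeff
  · exact mem_support_iff.1 hM (by simpa using hcoeff)
  · intro m hm hne
    refine if_neg fun h1 => hne (Finsupp.ext (Fin.forall_fin_two.2 ⟨?_, h1⟩))
    rw [(Finset.mem_filter.1 hm).2, hMdeg]

theorem aeval_biHom_of_eq_zero {a b : Fin 2 → L} (ha : a 0 = 0) (hb : b 0 ≠ 0) :
    aeval (Sum.elim a b) (biHom p) =
      a 1 ^ p.degreeOf 0 * b 0 ^ p.degreeOf 1 *
        Polynomial.aeval (b 1 / b 0) (leadingCoeffX p) := by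
  rw [aeval_biHom, leadingCoeffX, map_sum, Finset.mul_sum, Finset.sum_filter]
  refine Finset.sum_congr rfl fun m hm => ?_
  rw [pow_sub_mul_pow_eq hb _ (monomial_le_degreeOf 1 hm)]
  split_ifs with hdeg
  · rw [Polynomial.aeval_monomial, hdeg, Nat.sub_self, pow_zero]
    ring
  · have hlt := lt_of_le_of_ne (monomial_le_degreeOf 0 hm) hdeg
    rw [ha, zero_pow (Nat.sub_ne_zero_of_lt hlt), zero_mul, mul_zero, zero_mul]

theorem aeval_biHom_line_ne_zero (hp : Irreducible p) (hpx : p.degreeOf 0 ≠ 0)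
    (hpy : p.degreeOf 1 ≠ 0) {a : Fin 2 → K} (ha : a ≠ 0) {b : Fin 2 → L} (hb : b 0 ≠ 0)
    (ht : Transcendental K (b 1 / b 0)) :
    aeval (Sum.elim (algebraMap K L ∘ a) b) (biHom p) ≠ 0 := by
  by_cases h0 : a 0 = 0
  · have h1 : a 1 ≠ 0 := fun h1 => ha (funext (Fin.forall_fin_two.2 ⟨h0, h1⟩))
    rw [aeval_biHom_of_eq_zero (by simp [h0]) hb]
    exact mul_ne_zero (mul_ne_zero (pow_ne_zero _ ((map_ne_zero _).2 h1)) (pow_ne_zero _ hb))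
      fun h => leadingCoeffX_ne_zero hp.ne_zero (transcendental_iff.1 ht _ h)
  · have h0' : algebraMap K L (a 0) ≠ 0 := (map_ne_zero _).2 h0
    rw [aeval_biHom_of_ne_zero h0' hb, Function.comp_apply, Function.comp_apply, ← map_div₀]
    exact mul_ne_zero (mul_ne_zero (pow_ne_zero _ h0') (pow_ne_zero _ hb))
      (aeval_algebraMap_ne_zero hp hpx hpy _ ht)

theorem aeval_biHom_line_ne_zero' (hp : Irreducible p) (hpx : p.degreeOf 0 ≠ 0)
    (hpy : p.degreeOf 1 ≠ 0) {a : Fin 2 → L} (ha : a 0 ≠ 0)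
    (ht : Transcendental K (a 1 / a 0)) {b : Fin 2 → K} (hb : b ≠ 0) :
    aeval (Sum.elim a (algebraMap K L ∘ b)) (biHom p) ≠ 0 := by
  rw [← aeval_biHom_rename_swap]
  exact aeval_biHom_line_ne_zero (irreducible_rename_swap hp)
    (by rwa [degreeOf_rename_swap, Equiv.swap_apply_left])
    (by rwa [degreeOf_rename_swap, Equiv.swap_apply_right]) hb ha ht

theorem coords_ne_zero (s : OnePoint K) : coords s ≠ 0 := by
  induction s using OnePoint.rec with
  | infty => exact fun h => one_ne_zero (congrFun h 1)
  | coe a => exact fun h => one_ne_zero (congrFun h 0)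

theorem map_aeval_sumElim {R S : Type*} [CommRing R] [Algebra K R] [CommRing S] [Algebra K S]
    (σ : R →ₐ[K] S) (a b : Fin 2 → R) (q : MvPolynomial (Fin 2 ⊕ Fin 2) K) :
    σ (aeval (Sum.elim a b) q) = aeval (Sum.elim (σ ∘ a) (σ ∘ b)) q := by
  rw [comp_aeval_apply, ← Sum.comp_elim]
  rfl

theorem finite_setOf_eval_biHom_eq_zero (hp : Irreducible p) (hpx : p.degreeOf 0 ≠ 0)
    (hpy : p.degreeOf 1 ≠ 0) (c : OnePoint K) :
    {t : OnePoint K | eval (Sum.elim (coords c) (coords t)) (biHom p) = 0}.Finite := by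
  classical
  let Q : Polynomial K :=
    aeval (Sum.elim (algebraMap K _ ∘ coords c) ![1, Polynomial.X]) (biHom p)
  have hmap {S : Type w} [CommRing S] [Algebra K S] (σ : Polynomial K →ₐ[K] S) :
      σ Q = aeval (Sum.elim (algebraMap K S ∘ coords c) ![1, σ Polynomial.X]) (biHom p) := by
    rw [map_aeval_sumElim]
    congr 3
    · exact funext fun i => σ.commutes _
    · exact funext (Fin.forall_fin_two.2 ⟨map_one σ, rfl⟩)
  have hQ : Q ≠ 0 := by
    have htr : Transcendental K (RatFunc.X / 1 : RatFunc K) := by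
      rw [div_one]
      exact RatFunc.transcendental_X
    refine fun h => aeval_biHom_line_ne_zero (b := ![1, RatFunc.X]) hp hpx hpy (coords_ne_zero c)
      one_ne_zero htr ?_
    have hX := hmap (IsScalarTower.toAlgHom K (Polynomial K) (RatFunc K))
    rwa [h, map_zero, IsScalarTower.coe_toAlgHom', RatFunc.algebraMap_X, eq_comm] at hX
  refine ((Q.roots.toFinset.finite_toSet.image ((↑) : K → OnePoint K)).insert ∞).subset
    fun t ht => ?_
  induction t using OnePoint.rec with
  | infty => exact Set.mem_insert _ _
  | coe b =>
    refine Set.mem_insert_of_mem _ ⟨b, ?_, rfl⟩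
    rw [Finset.mem_coe, Multiset.mem_toFinset, Polynomial.mem_roots hQ, Polynomial.IsRoot.def,
      ← Polynomial.coe_aeval_eq_eval, hmap, Polynomial.aeval_X]
    exact ht

theorem finite_curve_fst (hp : Irreducible p) (hpx : p.degreeOf 0 ≠ 0) (hpy : p.degreeOf 1 ≠ 0)
    (c : OnePoint K) : {s ∈ curve p | s.1 = c}.Finite := by
  refine ((finite_setOf_eval_biHom_eq_zero hp hpx hpy c).image (Prod.mk c)).subset ?_
  rintro ⟨_, t⟩ ⟨ht, rfl⟩
  exact ⟨t, ht, rfl⟩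

theorem finite_curve_snd (hp : Irreducible p) (hpx : p.degreeOf 0 ≠ 0) (hpy : p.degreeOf 1 ≠ 0)
    (c : OnePoint K) : {s ∈ curve p | s.2 = c}.Finite := by
  have hfin := finite_setOf_eval_biHom_eq_zero (irreducible_rename_swap hp)
    (by rwa [degreeOf_rename_swap, Equiv.swap_apply_left])
    (by rwa [degreeOf_rename_swap, Equiv.swap_apply_right]) c
  refine (hfin.image fun t => (t, c)).subset ?_
  rintro ⟨t, _⟩ ⟨ht, rfl⟩
  exact ⟨t, (aeval_biHom_rename_swap p _ _).trans ht, rfl⟩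

end BiHom

section MoebiusCoords

variable {R S L : Type*} [CommRing R] [Algebra K R] [CommRing S] [Algebra K S] [Field L]
  [Algebra K L] {Γ₀ : Type*} [LinearOrderedCommGroupWithZero Γ₀] {v : Valuation L Γ₀}

/-- Homogeneous coordinates of `(a z + b) / (c z + d)`, where `A = (a b; c d)`, in terms of
`t = z⁻¹`; unlike the fraction, they make sense for `t = 0`, i.e. for `z = ∞`. -/
def moebiusCoords (A : GL (Fin 2) K) (t : R) : Fin 2 → R :=
  ![algebraMap K R (A.1 1 0) + algebraMap K R (A.1 1 1) * t,
    algebraMap K R (A.1 0 0) + algebraMap K R (A.1 0 1) * t]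

theorem ne_zero_of_transcendental {z : L} (hz : Transcendental K z) : z ≠ 0 :=
  fun h => hz (h ▸ isAlgebraic_zero)

theorem comp_moebiusCoords (σ : R →ₐ[K] S) (A : GL (Fin 2) K) (t : R) :
    σ ∘ moebiusCoords A t = moebiusCoords A (σ t) :=
  funext (Fin.forall_fin_two.2 (by simp [moebiusCoords]))

theorem moebiusCoords_zero (A : GL (Fin 2) K) :
    moebiusCoords A (0 : R) = algebraMap K R ∘ moebiusCoords A (0 : K) := by
  rw [← map_zero (Algebra.ofId K R), ← comp_moebiusCoords]
  rfl

theorem moebiusCoords_zero_ne_zero (A : GL (Fin 2) K) : moebiusCoords A (0 : K) ≠ 0 := by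
  intro h
  have h10 : A.1 1 0 = 0 := by simpa [moebiusCoords] using congrFun h 0
  have h00 : A.1 0 0 = 0 := by simpa [moebiusCoords] using congrFun h 1
  exact A.det_ne_zero (by rw [Matrix.det_fin_two, h10, h00, zero_mul, mul_zero, sub_zero])

open Classical in
theorem exists_smul_infty_eq (s : OnePoint K) :
    ∃ A : GL (Fin 2) K, A • (∞ : OnePoint K) = s ∧ moebiusCoords A (0 : K) = coords s := by
  induction s using OnePoint.rec with
  | infty => exact ⟨1, one_smul _ _, by simp [moebiusCoords, coords]⟩
  | coe a =>
    refine ⟨.mkOfDetNeZero !![a, 1; 1, 0] (by simp), ?_, ?_⟩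
    · simp [OnePoint.smul_infty_eq_ite, Matrix.GeneralLinearGroup.mkOfDetNeZero]
    · simp [moebiusCoords, coords, Matrix.GeneralLinearGroup.mkOfDetNeZero]

theorem moebiusCoords_inv_ne_zero (A : GL (Fin 2) K) {z : L} (hz : Transcendental K z) :
    moebiusCoords A z⁻¹ 0 ≠ 0 := by
  have hmul : moebiusCoords A z⁻¹ 0 =
      (algebraMap K L (A.1 1 0) * z + algebraMap K L (A.1 1 1)) * z⁻¹ := by
    rw [add_mul, mul_inv_cancel_right₀ (ne_zero_of_transcendental hz)]
    rfl
  rw [hmul]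
  exact mul_ne_zero (moebiusAt_denominator_ne_zero A hz)
    (inv_ne_zero (ne_zero_of_transcendental hz))

theorem moebiusCoords_inv_div (A : GL (Fin 2) K) {z : L} (hz : z ≠ 0) :
    moebiusCoords A z⁻¹ 1 / moebiusCoords A z⁻¹ 0 = moebiusAt A z := by
  rw [moebiusAt, ← mul_div_mul_right (_ + _) _ (inv_ne_zero hz), add_mul, add_mul,
    mul_inv_cancel_right₀ hz, mul_inv_cancel_right₀ hz]
  rfl

theorem aeval_biHom_moebiusCoords_eq_zero_iff (p : Poly2 K) (A B : GL (Fin 2) K) {x y : L}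
    (hx : Transcendental K x) (hy : Transcendental K y) :
    MvPolynomial.aeval (Sum.elim (moebiusCoords A x⁻¹) (moebiusCoords B y⁻¹)) (biHom p) = 0 ↔
      MvPolynomial.aeval ![moebiusAt A x, moebiusAt B y] p = 0 := by
  have hA := moebiusCoords_inv_ne_zero A hx
  have hB := moebiusCoords_inv_ne_zero B hy
  rw [aeval_biHom_of_ne_zero hA hB, moebiusCoords_inv_div A (ne_zero_of_transcendental hx),
    moebiusCoords_inv_div B (ne_zero_of_transcendental hy),
    mul_eq_zero_iff_left (mul_ne_zero (pow_ne_zero _ hA) (pow_ne_zero _ hB))]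

theorem transcendental_moebiusCoords_div [v.IsTrivialOn K] (A : GL (Fin 2) K) {z : L}
    (hz : 1 < v z) : Transcendental K (moebiusCoords A z⁻¹ 1 / moebiusCoords A z⁻¹ 0) := by
  classical
  rw [moebiusCoords_inv_div A (v.pos_iff.1 (zero_lt_one.trans hz))]
  exact (near_smul_infty_moebiusAt A hz).transcendental

end MoebiusCoords

section Branch

open Polynomial

variable {p : Poly2 K}

/-- The local equation of the curve at a point, in the coordinates `t = x⁻¹` (the power series
variable) and `X = y⁻¹`, after a transformation `(A, B)` that maps `(∞, ∞)` to the point. -/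
def localEquation (p : Poly2 K) (A B : GL (Fin 2) K) : (PowerSeries K)[X] :=
  MvPolynomial.aeval (Sum.elim (moebiusCoords A (C PowerSeries.X)) (moebiusCoords B X)) (biHom p)

theorem map_localEquation {S : Type*} [CommRing S] [Algebra K S] (σ : (PowerSeries K)[X] →+* S)
    (hσ : ∀ c, σ (algebraMap K _ c) = algebraMap K S c) (p : Poly2 K) (A B : GL (Fin 2) K) :
    σ (localEquation p A B) = MvPolynomial.aeval
      (Sum.elim (moebiusCoords A (σ (C PowerSeries.X))) (moebiusCoords B (σ X))) (biHom p) := by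
  let σ' : (PowerSeries K)[X] →ₐ[K] S := { σ with commutes' := hσ }
  change σ' _ = MvPolynomial.aeval (Sum.elim (moebiusCoords A (σ' _)) (moebiusCoords B (σ' _))) _
  rw [localEquation, map_aeval_sumElim, comp_moebiusCoords, comp_moebiusCoords]

theorem aeval_map_localEquation {S : Type*} [CommRing S] [Algebra K S] (p : Poly2 K)
    (A B : GL (Fin 2) K) (y : S) :
    aeval y ((localEquation p A B).map PowerSeries.constantCoeff) = MvPolynomial.aeval
      (Sum.elim (algebraMap K S ∘ moebiusCoords A (0 : K)) (moebiusCoords B y)) (biHom p) := by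
  have h := map_localEquation ((aeval y : K[X] →ₐ[K] S).toRingHom.comp
    (mapRingHom PowerSeries.constantCoeff)) (fun c => by simp) p A B
  rw [← moebiusCoords_zero]
  simpa using h

theorem map_localEquation_ne_zero (hp : Irreducible p) (hpx : p.degreeOf 0 ≠ 0)
    (hpy : p.degreeOf 1 ≠ 0) (A B : GL (Fin 2) K) :
    (localEquation p A B).map PowerSeries.constantCoeff ≠ 0 := by
  have hx := one_lt_hahnVal_serX (K := K)
  intro h
  have hzero := aeval_map_localEquation p A B (serX K)⁻¹
  rw [h, map_zero, eq_comm] at hzero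
  exact aeval_biHom_line_ne_zero hp hpx hpy (moebiusCoords_zero_ne_zero A)
    (moebiusCoords_inv_ne_zero B (transcendental_of_one_lt_valuation hx))
    (transcendental_moebiusCoords_div B hx) hzero

theorem inv_serX : (serX K)⁻¹ = HahnSeries.single 1 1 := by
  refine inv_eq_of_mul_eq_one_left ?_
  rw [serX, HahnSeries.single_mul_single]
  simp

theorem exists_branch [IsAlgClosed K] [CharZero K] (hp : Irreducible p) (hpx : p.degreeOf 0 ≠ 0)
    (hpy : p.degreeOf 1 ≠ 0) (A B : GL (Fin 2) K)
    (h : MvPolynomial.eval (Sum.elim (moebiusCoords A 0) (moebiusCoords B 0)) (biHom p) = 0) :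
    ∃ φ : HahnSeries ℚ K, IsPuiseux φ ∧ 1 < hahnVal K φ ∧
      MvPolynomial.aeval ![moebiusAt A (serX K), moebiusAt B φ] p = 0 := by
  have hx := one_lt_hahnVal_serX (K := K)
  have hxt := transcendental_of_one_lt_valuation (K := K) hx
  have hroot : ((localEquation p A B).map PowerSeries.constantCoeff).IsRoot 0 :=
    (aeval_map_localEquation p A B (0 : K)).trans h
  obtain ⟨N, hN, ψ, hψ, hψroot⟩ :=
    hasPuiseuxRoot_of_isRoot_map (map_localEquation_ne_zero hp hpx hpy A B) hroot
  have hN' := Nat.pos_of_ne_zero hN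
  have hzero : MvPolynomial.aeval (Sum.elim (moebiusCoords A (serX K)⁻¹)
      (moebiusCoords B (powerSeriesHom K hN' ψ))) (biHom p) = 0 := by
    have hmap := map_localEquation ((powerSeriesHom K hN').toRingHom.comp
      (eval₂RingHom (expandHom K N hN) ψ)) (fun c => ?_) p A B
    · simpa [hψroot, ← map_pow, powerSeriesHom_X_pow, ← inv_serX] using hmap.symm
    · simpa using ((powerSeriesHom K hN').comp (PowerSeries.expand N hN)).commutes c
  have hne : powerSeriesHom K hN' ψ ≠ 0 := by
    intro h0
    rw [h0, moebiusCoords_zero] at hzero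
    exact aeval_biHom_line_ne_zero' hp hpx hpy (moebiusCoords_inv_ne_zero A hxt)
      (transcendental_moebiusCoords_div A hx) (moebiusCoords_zero_ne_zero B) hzero
  have hlarge : 1 < hahnVal K (powerSeriesHom K hN' ψ)⁻¹ := by
    rw [map_inv₀, one_lt_inv₀ ((hahnVal K).pos_iff.2 hne)]
    exact hahnVal_powerSeriesHom_lt_one hN' hψ
  refine ⟨_, isPuiseux_inv_powerSeriesHom hN' ψ, hlarge, ?_⟩
  rwa [← aeval_biHom_moebiusCoords_eq_zero_iff p A B hxt
    (transcendental_of_one_lt_valuation hlarge), inv_inv]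

end Branch

section Poles

open MvPolynomial

theorem one_lt_valuation_sub {L : Type*} [Field L] {Γ₀ : Type*}
    [LinearOrderedCommGroupWithZero Γ₀] {v : Valuation L Γ₀} {a b : L}
    (h : ¬ (1 < v a ↔ 1 < v b)) : 1 < v (a - b) := by
  rcases lt_or_ge 1 (v a) with ha | ha
  · have hb : v b ≤ 1 := by simpa [ha] using h
    rwa [v.map_sub_eq_of_lt_left (hb.trans_lt ha)]
  · have hb : 1 < v b := by simpa [ha.not_gt] using h
    rwa [v.map_sub_eq_of_lt_right (ha.trans_lt hb)]

theorem valuation_aeval_sub_lt_one {σ L : Type*} [Field L] [Algebra K L] {Γ₀ : Type*}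
    [LinearOrderedCommGroupWithZero Γ₀] {v : Valuation L Γ₀} [v.IsTrivialOn K] {a : σ → L}
    {c : σ → K} (h : ∀ i, v (a i - algebraMap K L (c i)) < 1) (q : MvPolynomial σ K) :
    v (aeval a q - algebraMap K L (eval c q)) < 1 := by
  have hconst (d : K) : v (algebraMap K L d) ≤ 1 :=
    Valuation.IsTrivialOn.valuation_algebraMap_le_one v d
  induction q using MvPolynomial.induction_on with
  | C d => simp
  | add q₁ q₂ h₁ h₂ =>
    rw [map_add, map_add, map_add, add_sub_add_comm]
    exact v.map_add_lt h₁ h₂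
  | mul_X q i hq =>
    have hsplit : aeval a (q * X i) - algebraMap K L (eval c (q * X i)) =
        (aeval a q - algebraMap K L (eval c q)) * a i +
          algebraMap K L (eval c q) * (a i - algebraMap K L (c i)) := by
      simp only [map_mul, aeval_X, eval_X]
      ring
    have hi : v (a i) ≤ 1 := by
      rw [← sub_add_cancel (a i) (algebraMap K L (c i))]
      exact v.map_add_le (h i).le (hconst _)
    rw [hsplit]
    refine v.map_add_lt ?_ ?_ <;> rw [map_mul]
    · exact mul_lt_one_of_lt_of_le hq hi
    · exact Right.mul_lt_one_of_le_of_lt (hconst _) (h i)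

theorem infty_mem_curve {L : Type*} [Field L] [Algebra K L] {Γ₀ : Type*}
    [LinearOrderedCommGroupWithZero Γ₀] {v : Valuation L Γ₀} [v.IsTrivialOn K] (p : Poly2 K)
    {x y : L} (hx : 1 < v x) (hy : 1 < v y) (h : aeval ![x, y] p = 0) :
    ((∞, ∞) : Pt K) ∈ curve p := by
  have hx₀ : x ≠ 0 := v.pos_iff.1 (zero_lt_one.trans hx)
  have hy₀ : y ≠ 0 := v.pos_iff.1 (zero_lt_one.trans hy)
  have hzero : aeval (Sum.elim ![x⁻¹, 1] ![y⁻¹, 1]) (biHom p) = 0 := by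
    rw [aeval_biHom_of_ne_zero (inv_ne_zero hx₀) (inv_ne_zero hy₀)]
    simp [h]
  have hlim := valuation_aeval_sub_lt_one (v := v) (a := Sum.elim ![x⁻¹, 1] ![y⁻¹, 1])
    (c := Sum.elim (coords ∞) (coords ∞)) (fun i => ?_) (biHom p)
  · rw [hzero, zero_sub, v.map_neg] at hlim
    by_contra hne
    exact hlim.ne (Valuation.IsTrivialOn.eq_one _ hne)
  · rcases i with i | i <;> fin_cases i <;> simp [coords, inv_lt_one_of_one_lt₀, hx, hy]

variable {p : Poly2 K} {r : RatFun K} {f g : RatFunc K}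

theorem isPole_of_isUnivPole [IsAlgClosed K] [CharZero K] (hp : Irreducible p)
    (hpx : p.degreeOf 0 ≠ 0) (hpy : p.degreeOf 1 ≠ 0) (hfg : (f, g) ∈ sepSet r p) {s : Pt K}
    (hs : s ∈ curve p) (h : ¬ (IsUnivPole f s.1 ↔ IsUnivPole g s.2)) : IsPole r p s := by
  classical
  obtain ⟨A, hA, hA₀⟩ := exists_smul_infty_eq s.1
  obtain ⟨B, hB, hB₀⟩ := exists_smul_infty_eq s.2
  obtain ⟨φ, hpuiseux, hφ, hzero⟩ :=
    exists_branch hp hpx hpy A B (by rw [hA₀, hB₀]; exact hs)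
  have hx := one_lt_hahnVal_serX (K := K)
  have hxt := transcendental_of_one_lt_valuation (K := K) hx
  have hφt := transcendental_of_one_lt_valuation (K := K) hφ
  have hnear₁ := hA ▸ near_smul_infty_moebiusAt A hx
  have hnear₂ := hB ▸ near_smul_infty_moebiusAt B hφ
  have hcomp := (aeval_polyComp_eq_zero_iff p A B hxt hφt).2 hzero
  refine ⟨hs, A⁻¹, B⁻¹, inv_smul_eq_iff.2 hA.symm, inv_smul_eq_iff.2 hB.symm, ?_⟩
  rw [inv_inv, inv_inv]
  refine ⟨infty_mem_curve _ hx hφ hcomp, φ, hpuiseux, hcomp, serDeg_pos_iff.2 hφ, ?_⟩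
  rw [serDeg_pos_iff, evalRat_ratComp hp hpx hfg A B hxt hφt hnear₁.transcendental
    hnear₂.transcendental hzero]
  rw [← hnear₁.one_lt_valuation_eval_iff, ← hnear₂.one_lt_valuation_eval_iff] at h
  exact one_lt_valuation_sub h

end Poles

/-! ### Infinite paths in locally finite graphs -/

section Graph

variable {V : Type*} {G : SimpleGraph V} {S P B : Set V}

theorem IsInfCycleFreePath.tail {v : ℕ → V} (h : IsInfCycleFreePath G v) (n : ℕ) :
    IsInfCycleFreePath G fun i => v (n + i) :=
  ⟨fun i => h.1 (n + i), fun i j hij => h.2 _ _ (by lia)⟩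

theorem IsInfCycleFreePath.injective {v : ℕ → V} (h : IsInfCycleFreePath G v) :
    Function.Injective v :=
  .of_lt_imp_ne h.2

theorem IsInfCycleFreePath.cons {v : V} {w : ℕ → V} (h : IsInfCycleFreePath G w)
    (hadj : G.Adj v (w 0)) (hv : ∀ i, w i ≠ v) :
    IsInfCycleFreePath G fun n => n.casesOn v w := by
  refine ⟨?_, ?_⟩
  · rintro (_ | i)
    · exact hadj
    · exact h.1 i
  · rintro (_ | i) (_ | j) hij
    · exact absurd hij (lt_irrefl 0)
    · exact (hv j).symm
    · exact absurd hij (Nat.not_lt_zero _)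
    · exact h.2 i j (Nat.lt_of_succ_lt_succ hij)

/-- The vertices reachable from `u` by a walk that prolongs the geodesics from `v` to `u` to
geodesics: the vertices below `u` in the geodesic order with root `v`. -/
def geodesicDescendants (G : SimpleGraph V) (v u : V) : Set V :=
  {w | G.Reachable u w ∧ G.dist v w = G.dist v u + G.dist u w}

theorem exists_adj_mem_geodesicDescendants {v u w : V} (hvu : G.Reachable v u)
    (hw : w ∈ geodesicDescendants G v u) (hwu : w ≠ u) :
    ∃ u', G.Adj u u' ∧ G.dist v u' = G.dist v u + 1 ∧ w ∈ geodesicDescendants G v u' := by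
  obtain ⟨q, hq⟩ := hw.1.exists_walk_length_eq_dist
  cases q with
  | nil => exact absurd rfl hwu
  | @cons _ u' _ hadj q' =>
    rw [SimpleGraph.Walk.length_cons] at hq
    have hlen : G.dist u' w ≤ q'.length := SimpleGraph.dist_le q'
    have hu' : G.dist v u' ≤ G.dist v u + 1 := by
      simpa only [SimpleGraph.dist_eq_one_iff_adj.2 hadj] using hvu.dist_triangle_left u'
    have hvw : G.dist v w ≤ G.dist v u' + G.dist u' w :=
      (hvu.trans hadj.reachable).dist_triangle_left w
    have hdist := hw.2
    exact ⟨u', hadj, by lia, q'.reachable, by lia⟩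

theorem exists_adj_infinite_geodesicDescendants {v u : V} (hfin : (G.neighborSet u).Finite)
    (hvu : G.Reachable v u) (hu : (geodesicDescendants G v u).Infinite) :
    ∃ u', G.Adj u u' ∧ G.dist v u' = G.dist v u + 1 ∧
      (geodesicDescendants G v u').Infinite := by
  by_contra! H
  have hnext : {u' | G.Adj u u' ∧ G.dist v u' = G.dist v u + 1}.Finite :=
    hfin.subset fun _ h => h.1
  refine hu (((hnext.biUnion fun u' h => H u' h.1 h.2).insert u).subset fun w hw => ?_)
  rcases eq_or_ne w u with rfl | hwu
  · exact Set.mem_insert _ _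
  · obtain ⟨u', hadj, hdist, hw'⟩ := exists_adj_mem_geodesicDescendants hvu hw hwu
    exact Set.mem_insert_of_mem _ (Set.mem_biUnion ⟨hadj, hdist⟩ hw')

/-- **Kőnig's lemma** for locally finite graphs. -/
theorem exists_isInfCycleFreePath_of_infinite (hfin : ∀ v, (G.neighborSet v).Finite) {v : V}
    (hv : {w | G.Reachable v w}.Infinite) :
    ∃ w : ℕ → V, IsInfCycleFreePath G w ∧ w 0 = v := by
  let T := {u : V // G.Reachable v u ∧ (geodesicDescendants G v u).Infinite}
  have hstep (u : T) : ∃ u' : T, G.Adj u.1 u'.1 ∧ G.dist v u'.1 = G.dist v u.1 + 1 := by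
    obtain ⟨u', hadj, hdist, hinf⟩ :=
      exists_adj_infinite_geodesicDescendants (hfin u) u.2.1 u.2.2
    exact ⟨⟨u', u.2.1.trans hadj.reachable, hinf⟩, hadj, hdist⟩
  choose next hadj hdist using hstep
  have hroot : (geodesicDescendants G v v).Infinite :=
    hv.mono fun w hw => ⟨hw, by rw [SimpleGraph.dist_self, zero_add]⟩
  let w (n : ℕ) : T := next^[n] ⟨v, SimpleGraph.Reachable.refl v, hroot⟩
  have hw (n : ℕ) : w (n + 1) = next (w n) := Function.iterate_succ_apply' _ _ _
  have hlevel (n : ℕ) : G.dist v (w n).1 = n := by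
    induction n with
    | zero => exact SimpleGraph.dist_self
    | succ n ih => rw [hw, hdist, ih]
  refine ⟨fun n => (w n).1, ⟨fun i => ?_, fun i j hij h => ?_⟩, rfl⟩
  · simp only [hw]
    exact hadj (w i)
  · have hlevels := congrArg (G.dist v) h
    simp only [hlevel] at hlevels
    exact hij.ne hlevels

/-- The vertices that cannot escape to infinity without meeting `S`; for the graph of an orbit `O`
this is `O(S)`. -/
def enclosure (G : SimpleGraph V) (S : Set V) : Set V :=
  {v | ¬ ∃ w : ℕ → V, IsInfCycleFreePath G w ∧ (∃ i, w i = v) ∧ ∀ i, w i ∉ S}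

/-- The graph `G` with the edges at the vertices in `S` removed; the vertices are kept, so that no
subtypes are needed. -/
def avoid (G : SimpleGraph V) (S : Set V) : SimpleGraph V where
  Adj v w := G.Adj v w ∧ v ∉ S ∧ w ∉ S
  symm := ⟨fun _ _ h => ⟨h.1.symm, h.2.2, h.2.1⟩⟩
  loopless := ⟨fun _ h => h.1.ne rfl⟩

/-- The elements of `P` from which an infinite path leads away from `P`. -/
def exits (G : SimpleGraph V) (P : Set V) : Set V :=
  {s | s ∈ P ∧ ∃ v : ℕ → V, IsInfCycleFreePath G v ∧ v 0 = s ∧ ∀ i, v i ∈ P → v i = s}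

theorem finite_reachable_of_mem_enclosure (hfin : ∀ v, (G.neighborSet v).Finite) {v : V}
    (hv : v ∈ enclosure G S) : {w | (avoid G S).Reachable v w}.Finite := by
  by_contra hinf
  obtain ⟨w, hw, hw₀⟩ := exists_isInfCycleFreePath_of_infinite (G := avoid G S)
    (fun v => (hfin v).subset fun u hu => hu.1) hinf
  exact hv ⟨w, ⟨fun i => (hw.1 i).1, hw.2⟩, ⟨0, hw₀⟩, fun i => (hw.1 i).2.1⟩

theorem exists_avoid_reachable_adj {v s : V} (hvs : G.Reachable v s) (hs : s ∈ S) (hv : v ∉ S) :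
    ∃ u, (avoid G S).Reachable v u ∧ ∃ s' ∈ S, G.Adj s' u := by
  obtain ⟨q⟩ := hvs
  induction q with
  | nil => exact absurd hs hv
  | @cons v v' s hadj _ ih =>
    by_cases hv' : v' ∈ S
    · exact ⟨v, SimpleGraph.Reachable.refl v, v', hv', hadj.symm⟩
    · obtain ⟨u, hu, h⟩ := ih hs hv'
      have hadj' : (avoid G S).Adj v v' := ⟨hadj, hv, hv'⟩
      exact ⟨u, hadj'.reachable.trans hu, h⟩

theorem finite_enclosure_empty (hconn : G.Preconnected) (hfin : ∀ v, (G.neighborSet v).Finite) :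
    (enclosure G ∅).Finite := by
  rcases (enclosure G ∅).eq_empty_or_nonempty with h | ⟨v, hv⟩
  · rw [h]
    exact Set.finite_empty
  · have havoid : avoid G ∅ = G := by ext; simp [avoid]
    refine (finite_reachable_of_mem_enclosure hfin hv).subset fun w _ => ?_
    rw [havoid]
    exact hconn v w

theorem finite_enclosure (hconn : G.Preconnected) (hfin : ∀ v, (G.neighborSet v).Finite)
    (hS : S.Finite) : (enclosure G S).Finite := by
  rcases S.eq_empty_or_nonempty with rfl | ⟨s, hs⟩
  · exact finite_enclosure_empty hconn hfin
  let N := {u | (∃ s ∈ S, G.Adj s u) ∧ {w | (avoid G S).Reachable u w}.Finite}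
  have hN : N.Finite := (hS.biUnion fun s _ => hfin s).subset fun u ⟨⟨s, hs, hadj⟩, _⟩ =>
    Set.mem_biUnion hs hadj
  refine (hS.union (hN.biUnion fun u hu => hu.2)).subset fun v hv => ?_
  by_cases hvS : v ∈ S
  · exact Or.inl hvS
  · obtain ⟨u, hvu, hadj⟩ := exists_avoid_reachable_adj (hconn v s) hs hvS
    have hu : {w | (avoid G S).Reachable u w}.Finite :=
      (finite_reachable_of_mem_enclosure hfin hv).subset fun w hw => hvu.trans hw
    exact Or.inr (Set.mem_biUnion (show u ∈ N from ⟨hadj, hu⟩) hvu.symm)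

theorem subset_enclosure : S ⊆ enclosure G S :=
  fun _ hv ⟨_, _, ⟨i, hi⟩, h⟩ => h i (hi ▸ hv)

theorem vertexBoundary_enclosure_subset : vertexBoundary G (enclosure G S) ⊆ S := by
  rintro v ⟨hv, w, hw, hadj⟩
  obtain ⟨u, hu, ⟨i, rfl⟩, huS⟩ := not_not.1 hw
  by_contra hvS
  by_cases hmem : ∃ j, u j = v
  · exact hv ⟨u, hu, hmem, huS⟩
  · push Not at hmem
    refine hv ⟨_, (hu.tail i).cons hadj fun _ => hmem _, ⟨0, rfl⟩, ?_⟩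
    rintro (_ | k)
    · exact hvS
    · exact huS _

theorem exits_subset_vertexBoundary_enclosure :
    exits G P ⊆ vertexBoundary G (enclosure G (exits G P)) := by
  intro v hv
  refine ⟨subset_enclosure hv, ?_⟩
  obtain ⟨-, w, hw, rfl, hP⟩ := hv
  refine ⟨w 1, fun h => h ⟨_, hw.tail 1, ⟨0, rfl⟩, fun i hi => ?_⟩, hw.1 0⟩
  exact hw.2 0 (1 + i) (by lia) (hP _ hi.1).symm

theorem vertexBoundary_enclosure_exits :
    vertexBoundary G (enclosure G (exits G P)) = exits G P :=
  vertexBoundary_enclosure_subset.antisymm exits_subset_vertexBoundary_enclosure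

theorem subset_enclosure_exits (hB : B.Finite) (hPB : P ⊆ B) (hBP : vertexBoundary G B ⊆ P) :
    B ⊆ enclosure G (exits G P) := by
  rintro v hv ⟨w, hw, ⟨i, rfl⟩, hS⟩
  have hfin : {j | w j ∈ B}.Finite := hB.preimage hw.injective.injOn
  obtain ⟨j, hj, hmax⟩ := hfin.exists_maximal ⟨i, hv⟩
  have hlast (k : ℕ) (hk : j < k) : w k ∉ B := fun hkB => (hmax hkB hk.le).not_gt hk
  have hjP : w j ∈ P := hBP ⟨hj, w (j + 1), hlast _ (lt_add_one j), hw.1 j⟩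
  refine hS j ⟨hjP, _, hw.tail j, rfl, fun k hk => ?_⟩
  rcases k.eq_zero_or_pos with rfl | hk₀
  · rfl
  · exact absurd (hPB hk) (hlast _ (by lia))

end Graph

/-! ### Orbits -/

section Orbits

theorem finite_isUnivPole (f : RatFunc K) : {s : OnePoint K | IsUnivPole f s}.Finite := by
  classical
  refine ((f.denom.roots.toFinset.finite_toSet.image ((↑) : K → OnePoint K)).insert ∞).subset
    fun s hs => ?_
  induction s using OnePoint.rec with
  | infty => exact Set.mem_insert _ _
  | coe a =>
    have hpole : (0 : ℤ) < f.denom.rootMultiplicity a - f.num.rootMultiplicity a := hs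
    refine Set.mem_insert_of_mem _ ⟨a, ?_, rfl⟩
    rw [Finset.mem_coe, Multiset.mem_toFinset, Polynomial.mem_roots f.denom_ne_zero,
      ← Polynomial.rootMultiplicity_pos f.denom_ne_zero]
    lia

variable {p : Poly2 K} {O : Set (curve p)}

theorem injective_orbit_val : Function.Injective fun v : O => v.1.1 :=
  Subtype.val_injective.comp Subtype.val_injective

theorem finite_orbit_fst_eq (hp : Irreducible p) (hpx : p.degreeOf 0 ≠ 0)
    (hpy : p.degreeOf 1 ≠ 0) (c : OnePoint K) : {v : O | v.1.1.1 = c}.Finite :=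
  ((finite_curve_fst hp hpx hpy c).preimage injective_orbit_val.injOn).subset
    fun v hv => ⟨v.1.2, hv⟩

theorem finite_orbit_snd_eq (hp : Irreducible p) (hpx : p.degreeOf 0 ≠ 0)
    (hpy : p.degreeOf 1 ≠ 0) (c : OnePoint K) : {v : O | v.1.1.2 = c}.Finite :=
  ((finite_curve_snd hp hpx hpy c).preimage injective_orbit_val.injOn).subset
    fun v hv => ⟨v.1.2, hv⟩

theorem finite_neighborSet_orbitGraph (hp : Irreducible p) (hpx : p.degreeOf 0 ≠ 0)
    (hpy : p.degreeOf 1 ≠ 0) (v : O) : ((orbitGraph O).neighborSet v).Finite :=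
  ((finite_orbit_fst_eq hp hpx hpy v.1.1.1).union (finite_orbit_snd_eq hp hpx hpy v.1.1.2)).subset
    fun _ hw => hw.2.imp Eq.symm Eq.symm

theorem orbitGraph_preconnected (hO : IsOrbit O) : (orbitGraph O).Preconnected := by
  obtain ⟨c, rfl⟩ := hO
  set O := {x | orbitSetoid p x c}
  have hreach (v w : curve p)
      (h : Relation.EqvGen (fun v w : curve p => v.1.1 = w.1.1 ∨ v.1.2 = w.1.2) v w) :
      ∀ (hv : v ∈ O) (hw : w ∈ O), (orbitGraph O).Reachable ⟨v, hv⟩ ⟨w, hw⟩ := by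
    induction h with
    | rel v w h =>
      intro hv hw
      rcases eq_or_ne v w with rfl | hvw
      · rfl
      · exact SimpleGraph.Adj.reachable (G := orbitGraph O) ⟨hvw ∘ congrArg Subtype.val, h⟩
    | refl v => exact fun _ _ => .rfl
    | symm v w _ ih => exact fun hv hw => (ih hw hv).symm
    | trans u v w huv _ ih₁ ih₂ =>
      intro hu hw
      have hv : v ∈ O := (huv.symm _ _).trans _ _ _ hu
      exact (ih₁ hu hv).trans (ih₂ hv hw)
  exact fun v w => hreach v.1 w.1 (v.2.trans _ _ _ (w.2.symm _ _)) v.2 w.2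

/-- The points of `O` at which `f`, as a function of the first coordinate, or `g`, as a function of
the second one, has a pole. -/
def coordPoles (f g : RatFunc K) (O : Set (curve p)) : Set O :=
  {v | IsUnivPole f v.1.1.1 ∨ IsUnivPole g v.1.1.2}

variable {r : RatFun K} {f g : RatFunc K}

theorem finite_coordPoles (hp : Irreducible p) (hpx : p.degreeOf 0 ≠ 0)
    (hpy : p.degreeOf 1 ≠ 0) : (coordPoles f g O).Finite := by
  refine (((finite_isUnivPole f).biUnion fun c _ => finite_orbit_fst_eq hp hpx hpy c).union
    ((finite_isUnivPole g).biUnion fun c _ => finite_orbit_snd_eq hp hpx hpy c)).subset ?_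
  rintro v (hv | hv)
  · exact Or.inl (Set.mem_biUnion hv rfl)
  · exact Or.inr (Set.mem_biUnion hv rfl)

theorem vertexBoundary_coordPoles_subset [IsAlgClosed K] [CharZero K] (hp : Irreducible p)
    (hpx : p.degreeOf 0 ≠ 0) (hpy : p.degreeOf 1 ≠ 0) (hfg : (f, g) ∈ sepSet r p) :
    vertexBoundary (orbitGraph O) (coordPoles f g O) ⊆ {v | IsPole r p v.1.1} := by
  rintro v ⟨hv, w, hw, -, hvw⟩
  obtain ⟨hwf, hwg⟩ := not_or.1 hw
  refine isPole_of_isUnivPole hp hpx hpy hfg v.1.2 fun hiff => ?_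
  rcases hvw with h | h
  · exact hwf (h ▸ hv.elim id hiff.2)
  · exact hwg (h ▸ hv.elim hiff.1 id)

end Orbits

end SepVar

end

theorem mainTheorem9 {K : Type*} [Field K] [IsAlgClosed K] [CharZero K]
    (p : MvPolynomial (Fin 2) K) (hp : Irreducible p)
    (hpx : p.degreeOf 0 ≠ 0) (hpy : p.degreeOf 1 ≠ 0)
    (r : FractionRing (MvPolynomial (Fin 2) K))
    (hr : r ∈ SepVar.localRing p) (hr' : r ∉ SepVar.localIdeal p)
    (f g : RatFunc K) (hfg : (f, g) ∈ SepVar.sepSet r p)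
    (O : Set (SepVar.curve p)) (hO : SepVar.IsOrbit O) :
    (SepVar.enclosed O (SepVar.specialPoles r O)).Finite ∧
    (∀ v : O, SepVar.IsUnivPole f v.1.1.1 ∨ SepVar.IsUnivPole g v.1.1.2 →
      v ∈ SepVar.enclosed O (SepVar.specialPoles r O)) ∧
    SepVar.vertexBoundary (SepVar.orbitGraph O)
      (SepVar.enclosed O (SepVar.specialPoles r O)) = SepVar.specialPoles r O := by
  open SepVar in
  have hB : (coordPoles f g O).Finite := finite_coordPoles hp hpx hpy
  have hPB : {v : O | IsPole r p v.1.1} ⊆ coordPoles f g O :=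
    fun _ hv => hv.isUnivPole_or hp hpx hfg
  have hS : (specialPoles r O).Finite := hB.subset fun _ hv => hPB hv.1
  refine ⟨?_, ?_, ?_⟩
  · exact finite_enclosure (orbitGraph_preconnected hO)
      (finite_neighborSet_orbitGraph hp hpx hpy) hS
  · exact subset_enclosure_exits hB hPB (vertexBoundary_coordPoles_subset hp hpx hpy hfg)
  · exact vertexBoundary_enclosure_exits
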